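/- **Setting.** Fix $n\ge 1$ actions, an order $k\ge 0$, a horizon $T\ge 1$, and for each action $a\in\{1,\dots,n\}$ a parameter vector $\gamma(a)=(\gamma_0(a),\dots,\gamma_k(a))\in\mathbb R^{k+1}$. In round $t=1,2,\dots$ the learner plays $a_t$ and observes $$x_t=\gamma_0(a_t)+\sum_{i=1}^k\gamma_i(a_t)\,x_{t-i}+\xi_t=\langle\gamma(a_t),z_{t-1}\rangle+\xi_t,\qquad z_{t-1}=(1,x_{t-1},\dots,x_{t-k})^{\mathsf T},$$ with $x_j=0$ for $j\le 0$. The noise $(\xi_t)_{t\ge1}$ is a sequence of random variables, the same for all policies, adapted to a filtration $(\mathcal F_t)$, and conditionally on $\mathcal F_{t-1}$ it has mean zero and is $\sigma^2$-subgaussian: $\mathbb E[e^{s\xi_t}\mid\mathcal F_{t-1}]\le e^{s^2\sigma^2/2}$ for all $s\in\mathbb R$ ($\sigma\ge0$). A policy $\pi$ chooses $a_t$ as a deterministic (measurable) function of the past actions and rewards; $J_T(\pi)=\mathbb E[\sum_{t=1}^Tx_t]$, a policy $\pi^*$ is optimal if it maximizes $J_T$, and the expected cumulative policy regret of $\pi$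 is $R(\pi,T)=J_T(\pi^*)-J_T(\pi)$. **Assumptions.** For every action $a$: $\gamma_i(a)\ge0$ for $0\le i\le k$; $\sum_{i=1}^k\gamma_i(a)\le\Gamma$ with $\Gamma<1$; $\gamma_0(a)\le m$. **Algorithm.** AR-UCB with regularization $\lambda>0$ and $\delta=1/(2T)$ keeps, for every action $a$, $V_0(a)=\lambda I_{k+1}$, $b_0(a)=0$, and updates $V_t(a)=V_{t-1}(a)+z_{t-1}z_{t-1}^{\mathsf T}\mathbf 1\{a=a_t\}$ and $b_t(a)=b_{t-1}(a)+z_{t-1}x_t\mathbf 1\{a=a_t\}$, with $\hat\gamma_t(a)=V_t(a)^{-1}b_t(a)$. For $t\le T$ it plays (ties broken arbitrarily) $$a_t\in\arg\max_a\ \langle\hat\gamma_{t-1}(a),z_{t-1}\rangle+\beta_{t-1}(a)\sqrt{z_{t-1}^{\mathsf T}V_{t-1}(a)^{-1}z_{t-1}},$$ $$\beta_t(a)=\sqrt{\lambda(m^2+1)}+\sigma\sqrt{2\log\frac n\delta+\log\frac{\det V_t(a)}{\lambda^{k+1}}}.$$ **Theorem 2.** Under these assumptions every policy has a finite expected cumulative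 reward, an optimal policy exists, and $$R(\text{AR-UCB},T)\le\widetilde O\!\left(\frac{(m^2+\sigma)(k+1)^{3/2}\sqrt{nT}}{(1-\Gamma)^2}\right).$$ Precisely: there is an absolute exponent $p\in\mathbb N$, and for all $\lambda>0$ and $c_0>0$ there is a constant $C=C(\lambda,c_0)$, such that for all $n,k,T,m,\sigma,\Gamma,\gamma$ and all noise as above with $m^2+\sigma\ge c_0$, $$R(\text{AR-UCB},T)\le C\,\frac{(m^2+\sigma)(k+1)^{3/2}\sqrt{nT}}{(1-\Gamma)^2}\left(1+\log\frac{nT(k+1)(1+m+\sigma)}{1-\Gamma}\right)^{p}.$$ -/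

import Mathlib

open MeasureTheory ProbabilityTheory
open scoped Matrix

noncomputable section

namespace ARBandit

/-- The observations of the first `t` rounds: entry `s : Fin t` is the pair
`(a_{s+1}, x_{s+1})` of the action played and the reward observed in round `s + 1`.
(The rewards preceding round `1` are the known constants `x_0 = x_{-1} = ... = 0`, so they
carry no information and are not recorded.) -/
abbrev History (n t : ℕ) : Type := Fin t → Fin n × ℝ

/-- A deterministic policy: in round `t + 1` it maps the history of the first `t` rounds to one
of the `n` actions; the maps are measurable, so that expected rewards make sense. -/
structure Policy (n : ℕ) where
  act : (t : ℕ) → History n t → Fin n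
  measurable_act : ∀ t, Measurable (act t)

/-- The context vector `z_t = (1, x_t, x_{t-1}, ..., x_{t-k+1})` after `t` rounds, with
`x_j = 0` for `j ≤ 0`. In particular `z_0 = (1, 0, ..., 0)`. -/
def context (k : ℕ) {n t : ℕ} (h : History n t) : Fin (k + 1) → ℝ :=
  Fin.cons 1 (fun i : Fin k =>
    if hi : (i : ℕ) + 1 ≤ t then (h ⟨t - ((i : ℕ) + 1), by omega⟩).2 else 0)

/-- The history generated by the policy `π` in the autoregressive bandit with parameter vectors
`γ a = (γ_0(a), ..., γ_k(a))` and noise `ξ_1, ξ_2, ...` :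
`a_{t+1} = π(H_t)` and `x_{t+1} = ⟨γ(a_{t+1}), z_t⟩ + ξ_{t+1}`. -/
def trajectory {n k : ℕ} (γ : Fin n → Fin (k + 1) → ℝ) (π : Policy n) (ξ : ℕ → ℝ) :
    (t : ℕ) → History n t
  | 0 => fun i => i.elim0
  | t + 1 =>
    let h : History n t := trajectory γ π ξ t
    let a : Fin n := π.act t h
    Fin.snoc (α := fun _ => Fin n × ℝ) h (a, γ a ⬝ᵥ context k h + ξ (t + 1))

/-- The sum `x_1 + ... + x_T` of the rewards collected by `π` in the first `T` rounds. -/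
def totalReward {n k : ℕ} (γ : Fin n → Fin (k + 1) → ℝ) (π : Policy n) (ξ : ℕ → ℝ) (T : ℕ) : ℝ :=
  ∑ s : Fin T, (trajectory γ π ξ T s).2

/-- The expected cumulative reward `J_T(π) = 𝔼[x_1 + ... + x_T]`. -/
def expectedReward {Ω : Type*} [MeasurableSpace Ω] (μ : Measure Ω) (ξ : ℕ → Ω → ℝ)
    {n k : ℕ} (γ : Fin n → Fin (k + 1) → ℝ) (T : ℕ) (π : Policy n) : ℝ :=
  ∫ ω, totalReward γ π (fun t => ξ t ω) T ∂μ

/-- `π` maximizes the expected cumulative reward over the horizon `T` among all policies. -/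
def IsOptimal {Ω : Type*} [MeasurableSpace Ω] (μ : Measure Ω) (ξ : ℕ → Ω → ℝ)
    {n k : ℕ} (γ : Fin n → Fin (k + 1) → ℝ) (T : ℕ) (π : Policy n) : Prop :=
  ∀ π' : Policy n, expectedReward μ ξ γ T π' ≤ expectedReward μ ξ γ T π

/-- `ξ_1, ξ_2, ...` is adapted to `ℱ` and, conditionally on the past `ℱ_t`, the variable `ξ_{t+1}`
has mean zero and is `σ²`-subgaussian:
`𝔼[exp (s ξ_{t+1}) | ℱ_t] ≤ exp (σ² s² / 2)` for all real `s`. -/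
structure IsSubgaussianNoise {Ω : Type*} [mΩ : MeasurableSpace Ω] (μ : Measure Ω)
    (ℱ : Filtration ℕ mΩ) (ξ : ℕ → Ω → ℝ) (σ : ℝ) : Prop where
  measurable : ∀ t : ℕ, Measurable[ℱ (t + 1)] (ξ (t + 1))
  integrable_exp : ∀ (t : ℕ) (s : ℝ), Integrable (fun ω => Real.exp (s * ξ (t + 1) ω)) μ
  condExp_eq_zero : ∀ t : ℕ, μ[ξ (t + 1) | ℱ t] =ᵐ[μ] 0
  condExp_exp_le : ∀ (t : ℕ) (s : ℝ),
    μ[fun ω => Real.exp (s * ξ (t + 1) ω) | ℱ t] ≤ᵐ[μ] fun _ => Real.exp (σ ^ 2 * s ^ 2 / 2)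

/-- The regularized Gram matrix `V_t(a)`: `V_0(a) = lam I` and
`V_{t+1}(a) = V_t(a) + z_t z_tᵀ 1{a = a_{t+1}}`. -/
def gram (k : ℕ) (lam : ℝ) {n : ℕ} :
    (t : ℕ) → History n t → Fin n → Matrix (Fin (k + 1)) (Fin (k + 1)) ℝ
  | 0, _, _ => lam • (1 : Matrix (Fin (k + 1)) (Fin (k + 1)) ℝ)
  | t + 1, h, a =>
    let h' : History n t := fun i => h i.castSucc
    gram k lam t h' a +
      if a = (h (Fin.last t)).1 then Matrix.vecMulVec (context k h') (context k h') else 0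

/-- The vector `b_t(a)`: `b_0(a) = 0` and `b_{t+1}(a) = b_t(a) + x_{t+1} z_t 1{a = a_{t+1}}`. -/
def responseVec (k : ℕ) {n : ℕ} : (t : ℕ) → History n t → Fin n → Fin (k + 1) → ℝ
  | 0, _, _ => 0
  | t + 1, h, a =>
    let h' : History n t := fun i => h i.castSucc
    responseVec k t h' a +
      if a = (h (Fin.last t)).1 then (h (Fin.last t)).2 • context k h' else 0

/-- The ridge estimate `V_t(a)⁻¹ b_t(a)` of the parameter vector of action `a`. -/
def estimate (k : ℕ) (lam : ℝ) {n t : ℕ} (h : History n t) (a : Fin n) : Fin (k + 1) → ℝ :=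
  (gram k lam t h a)⁻¹ *ᵥ responseVec k t h a

/-- The exploration coefficient
`β_t(a) = √(lam (m² + 1)) + σ √(2 log (n / δ) + log (det V_t(a) / lam^(k+1)))`. -/
def explorationCoeff (k : ℕ) (lam m σ δ : ℝ) {n t : ℕ} (h : History n t) (a : Fin n) : ℝ :=
  √(lam * (m ^ 2 + 1)) +
    σ * √(2 * Real.log (n / δ) + Real.log ((gram k lam t h a).det / lam ^ (k + 1)))

/-- The index of action `a` in round `t + 1`, given the history of the first `t` rounds:
the estimated reward plus `β_t(a)` times the norm of `z_t` induced by `V_t(a)⁻¹`. -/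
def ucb (k : ℕ) (lam m σ δ : ℝ) {n t : ℕ} (h : History n t) (a : Fin n) : ℝ :=
  estimate k lam h a ⬝ᵥ context k h +
    explorationCoeff k lam m σ δ h a *
      √(context k h ⬝ᵥ ((gram k lam t h a)⁻¹ *ᵥ context k h))

/-- `π` runs AR-UCB in the rounds `1, ..., T`: in every round it plays an action of maximal index
(ties are broken in any way). -/
def IsARUCB (k : ℕ) (lam m σ δ : ℝ) (T : ℕ) {n : ℕ} (π : Policy n) : Prop :=
  ∀ t < T, ∀ h : History n t, ∀ a : Fin n,
    ucb k lam m σ δ h a ≤ ucb k lam m σ δ h (π.act t h)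

end ARBandit

end

/-! Run all policies on the same noise. Since the coefficients are nonnegative, larger past rewards
can only help, so the greedy policy, which maximizes the conditional expected reward in every state,
dominates every policy path by path and is optimal (`reward_le_greedy`, `isOptimal_of_isGreedy`).
The gap d between its rewards and those of π satisfies d_{t+1} ≤ ∑ c_{t,i} d_{t-i} + r_t, where the
weights sum to at most Γ and r_t is the loss of π against the greedy action in π's own state. The
squares satisfy a recursion of the same kind, whence ∑ d² ≤ (k+1)/(1-Γ)² ∑ r²
(`sum_sq_le_of_subconvex_recursion`).

For AR-UCB, optimism gives r_t ≤ 2βw_t, with w_t the confidence width, whenever the confidence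
ellipsoids hold (`instRegret_le_width`); stability always gives r_t ≤ 2D, with D determined by the
largest noise. The elliptical potential lemma bounds ∑ min(1, w²) by log determinants, of order
n(k+1), and β² is of order k+1, so ∑ r² is of order n(k+1)² up to logarithms. Cauchy–Schwarz in time
then yields √(T(k+1) · n(k+1)²) = (k+1)^{3/2} √(nT). Comparing d and r in ℓ¹ instead would cost
another √(k+1).

In a fixed round the ellipsoids fail with probability at most δ: a self-normalized exponential
process keeps mean at most 1, because each round multiplies it by a Gaussian mixture of
conditionally subgaussian exponentials (`lintegral_mul_exp_mixture_le`,
`measure_not_concentrated_le`). With δ = 1/(2T) the expected number of failures is at most 1/2. As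
the noise is unbounded, powers of its maximum are first traded for powers of a logarithm plus
exponential moments (`sum_sq_instRegret_le_exp`); only then is the pathwise bound integrated
(`expectedReward_greedy_sub_le`). -/

namespace ARBandit

/-! ### Linear recursive inequalities -/

/-- A nonnegative sequence that is at most a subconvex combination of its last `k` terms plus a
perturbation has a sum controlled by the sum of the perturbations. -/
lemma sum_le_of_subconvex_recursion {k T : ℕ} {Γ : ℝ} (hΓ0 : 0 ≤ Γ) (hΓ1 : Γ < 1)
    {u ρ : ℕ → ℝ} (hρ : ∀ t, 0 ≤ ρ t) (hu0 : u 0 = 0) (c : ℕ → Fin k → ℝ)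
    (hc : ∀ t i, 0 ≤ c t i) (hcs : ∀ t, ∑ i, c t i ≤ Γ)
    (hrec : ∀ t, u (t + 1) ≤ ∑ i : Fin k, c t i * u (t - i) + ρ t) :
    ∑ t ∈ Finset.range T, u (t + 1) ≤ (k + 1) / (1 - Γ) * ∑ t ∈ Finset.range T, ρ t := by
  have hk : (0 : ℝ) < k + 1 := by positivity
  have h1 : 0 < 1 - Γ := by linarith
  -- Chosen so that Bernoulli's inequality gives (1 - ε)^k ≥ 1 - kε ≥ Γ: a contraction by Γ over k
  -- lags is then no stronger than a contraction by 1 - ε per step. The factor k + 1 arises because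
  -- the weights of many rounds may all point at the same past term.
  set ε : ℝ := (1 - Γ) / (k + 1) with hε
  have hε0 : 0 < ε := by positivity
  have hε1 : ε ≤ 1 := by
    rw [hε, div_le_one hk]
    have : (0 : ℝ) ≤ k := by positivity
    linarith
  have hq0 : 0 ≤ 1 - ε := by linarith
  have hqk : Γ ≤ (1 - ε) ^ k := by
    have h := one_add_mul_le_pow (a := -ε) (by linarith) k
    have : (k : ℝ) * ε ≤ 1 - Γ := by
      rw [hε, mul_div_assoc', div_le_iff₀ hk]
      nlinarith
    calc Γ ≤ 1 + k * (-ε) := by linarith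
      _ ≤ _ := by simpa [sub_eq_add_neg] using h
  -- A one-lag recursion that will dominate `u` and whose sum telescopes.
  let y : ℕ → ℝ := fun t => Nat.rec 0 (fun s z => (1 - ε) * z + ρ s) t
  have hy0 : y 0 = 0 := rfl
  have hys : ∀ t, y (t + 1) = (1 - ε) * y t + ρ t := fun t => rfl
  have hynn : ∀ t, 0 ≤ y t := by
    intro t
    induction t with
    | zero => exact hy0.ge
    | succ t ih => rw [hys]; have := hρ t; positivity
  -- As `ρ` is nonnegative, `y` loses at most a factor 1 - ε per step; indices truncated at 0 are
  -- harmless because `y 0 = 0`.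
  have hylag : ∀ i t, (1 - ε) ^ i * y (t - i) ≤ y t := by
    intro i
    induction i with
    | zero => intro t; simp
    | succ i ih =>
      intro t
      rcases t with _ | t
      · simp [hy0]
      · have h := ih t
        rw [Nat.add_sub_add_right, pow_succ', mul_assoc, hys]
        have := mul_le_mul_of_nonneg_left h hq0
        linarith [hρ t]
  have huy : ∀ t, u t ≤ y t := by
    intro t
    induction t using Nat.strong_induction_on with
    | _ t ih =>
      rcases t with _ | t
      · rw [hu0, hy0]
      · rw [hys]
        refine (hrec t).trans (add_le_add_left ?_ _)
        rcases eq_or_lt_of_le hΓ0 with h0 | hΓpos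
        · have hz : ∀ i, c t i = 0 := by
            have : ∑ i, c t i = 0 :=
              le_antisymm (by rw [h0]; exact hcs t) (Finset.sum_nonneg fun i _ => hc t i)
            intro i
            exact (Finset.sum_eq_zero_iff_of_nonneg fun i _ => hc t i).1 this i (Finset.mem_univ i)
          simp only [hz, zero_mul, Finset.sum_const_zero]
          exact mul_nonneg hq0 (hynn t)
        · have hterm : ∀ i : Fin k, u (t - i) ≤ (1 - ε) * y t / Γ := by
            intro i
            rw [le_div_iff₀ hΓpos]
            calc u (t - i) * Γ ≤ y (t - i) * Γ :=
                  mul_le_mul_of_nonneg_right (ih _ (by omega)) hΓ0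
              _ ≤ y (t - i) * (1 - ε) ^ ((i : ℕ) + 1) := by
                  refine mul_le_mul_of_nonneg_left (hqk.trans ?_) (hynn _)
                  exact pow_le_pow_of_le_one hq0 (by linarith) (by omega)
              _ = (1 - ε) * ((1 - ε) ^ (i : ℕ) * y (t - i)) := by ring
              _ ≤ _ := mul_le_mul_of_nonneg_left (hylag _ _) hq0
          calc ∑ i, c t i * u (t - i) ≤ ∑ i, c t i * ((1 - ε) * y t / Γ) :=
                Finset.sum_le_sum fun i _ => mul_le_mul_of_nonneg_left (hterm i) (hc t i)
            _ = (∑ i, c t i) * ((1 - ε) * y t / Γ) := by rw [Finset.sum_mul]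
            _ ≤ Γ * ((1 - ε) * y t / Γ) := by
                refine mul_le_mul_of_nonneg_right (hcs t) ?_
                have := hynn t
                positivity
            _ = _ := by field_simp
  have hysum : ε * ∑ t ∈ Finset.range T, y (t + 1) ≤ ∑ t ∈ Finset.range T, ρ t := by
    have h : ∀ T, ε * ∑ t ∈ Finset.range T, y (t + 1) + (1 - ε) * y T
        = ∑ t ∈ Finset.range T, ρ t := by
      intro T
      induction T with
      | zero => simp [hy0]
      | succ T ih => rw [Finset.sum_range_succ, Finset.sum_range_succ, ← ih, hys]; ring
    have := h T
    have := mul_nonneg hq0 (hynn T)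
    linarith
  calc ∑ t ∈ Finset.range T, u (t + 1) ≤ ∑ t ∈ Finset.range T, y (t + 1) :=
        Finset.sum_le_sum fun t _ => huy _
    _ ≤ (∑ t ∈ Finset.range T, ρ t) / ε := by rw [le_div_iff₀ hε0]; linarith
    _ = _ := by rw [hε]; field_simp

/-- Let A be the weighted sum of past terms. Cauchy–Schwarz gives A² ≤ Γ ∑ c d², and convexity gives
(A + r)² ≤ A²/Γ + r²/(1-Γ), so d² obeys the previous recursion with perturbation r²/(1-Γ). -/
lemma sum_sq_le_of_subconvex_recursion {k T : ℕ} {Γ : ℝ} (hΓ0 : 0 ≤ Γ) (hΓ1 : Γ < 1)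
    {d r : ℕ → ℝ} (hd : ∀ t, 0 ≤ d t) (hd0 : d 0 = 0) (c : ℕ → Fin k → ℝ)
    (hc : ∀ t i, 0 ≤ c t i) (hcs : ∀ t, ∑ i, c t i ≤ Γ)
    (hrec : ∀ t, d (t + 1) ≤ ∑ i : Fin k, c t i * d (t - i) + r t) :
    ∑ t ∈ Finset.range T, d (t + 1) ^ 2
      ≤ (k + 1) / (1 - Γ) ^ 2 * ∑ t ∈ Finset.range T, r t ^ 2 := by
  have h1 : 0 < 1 - Γ := by linarith
  have key := sum_le_of_subconvex_recursion (T := T) hΓ0 hΓ1 (u := fun t => d t ^ 2)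
    (ρ := fun t => r t ^ 2 / (1 - Γ)) (fun t => by positivity) (by simp [hd0]) c hc hcs ?_
  · refine key.trans (le_of_eq ?_)
    rw [← Finset.sum_div]
    field_simp
  · intro t
    set A := ∑ i : Fin k, c t i * d (t - i) with hA
    set B := ∑ i : Fin k, c t i * d (t - i) ^ 2 with hB
    have hA0 : 0 ≤ A := Finset.sum_nonneg fun i _ => mul_nonneg (hc t i) (hd _)
    have hB0 : 0 ≤ B := Finset.sum_nonneg fun i _ => mul_nonneg (hc t i) (sq_nonneg _)
    have hCS : A ^ 2 ≤ Γ * B := by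
      have h := Finset.sum_sq_le_sum_mul_sum_of_sq_le_mul Finset.univ
        (r := fun i : Fin k => c t i * d (t - i)) (f := fun i => c t i)
        (g := fun i => c t i * d (t - i) ^ 2) (fun i _ => hc t i)
        (fun i _ => mul_nonneg (hc t i) (sq_nonneg _)) (fun i _ => le_of_eq (by ring))
      exact h.trans (mul_le_mul_of_nonneg_right (hcs t) hB0)
    have hsq : d (t + 1) ^ 2 ≤ (A + r t) ^ 2 := pow_le_pow_left₀ (hd _) (hrec t) 2
    refine hsq.trans ?_
    rcases eq_or_lt_of_le hΓ0 with h0 | hΓpos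
    · have hA' : A = 0 := by
        rw [← h0, zero_mul] at hCS
        nlinarith
      rw [hA', ← h0]; simp [hB0]
    -- The defect in the convexity inequality is an explicit square.
    · have e : B + r t ^ 2 / (1 - Γ) - (A + r t) ^ 2
          = (B - A ^ 2 / Γ) + ((1 - Γ) * A - Γ * r t) ^ 2 / (Γ * (1 - Γ)) := by
        field_simp; ring
      have e1 : A ^ 2 / Γ ≤ B := by rw [div_le_iff₀ hΓpos]; linarith
      have e2 : 0 ≤ ((1 - Γ) * A - Γ * r t) ^ 2 / (Γ * (1 - Γ)) := by positivity
      show (A + r t) ^ 2 ≤ B + r t ^ 2 / (1 - Γ)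
      linarith

/-! ### Reward sequences -/

/-- The reward `x_t` collected in round `t`, with `x_0 = 0`. -/
noncomputable def reward {n k : ℕ} (γ : Fin n → Fin (k + 1) → ℝ) (π : Policy n) (ξ : ℕ → ℝ) :
    ℕ → ℝ
  | 0 => 0
  | t + 1 =>
    γ (π.act t (trajectory γ π ξ t)) ⬝ᵥ context k (trajectory γ π ξ t) + ξ (t + 1)

/-- The context vector of a sequence of rewards. -/
noncomputable def lagVec (k : ℕ) (x : ℕ → ℝ) (t : ℕ) : Fin (k + 1) → ℝ :=
  Fin.cons 1 (fun i : Fin k => x (t - i))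

section

variable {n k : ℕ} (γ : Fin n → Fin (k + 1) → ℝ) (π : Policy n) (ξ : ℕ → ℝ)

lemma trajectory_succ_castSucc (t : ℕ) (i : Fin t) :
    trajectory γ π ξ (t + 1) i.castSucc = trajectory γ π ξ t i := by
  simp [trajectory, Fin.snoc_castSucc]

lemma trajectory_succ_last (t : ℕ) :
    trajectory γ π ξ (t + 1) (Fin.last t)
      = (π.act t (trajectory γ π ξ t), reward γ π ξ (t + 1)) := by
  simp [trajectory, reward]

lemma trajectory_snd (t : ℕ) (s : Fin t) :
    (trajectory γ π ξ t s).2 = reward γ π ξ (s + 1) := by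
  induction t with
  | zero => exact s.elim0
  | succ t ih =>
    refine Fin.lastCases ?_ (fun i => ?_) s
    · simp [trajectory_succ_last]
    · rw [trajectory_succ_castSucc, ih]; rfl

lemma context_trajectory (t : ℕ) :
    context k (trajectory γ π ξ t) = lagVec k (reward γ π ξ) t := by
  unfold context lagVec
  congr 1
  funext i
  split_ifs with h
  · rw [trajectory_snd]
    congr 1
    show t - ((i : ℕ) + 1) + 1 = t - i
    omega
  -- Truncated subtraction sends every lag before the first round to index 0, where `reward` is 0,
  -- in agreement with the default value in `context`.
  · rw [show t - (i : ℕ) = 0 by omega]; rfl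

lemma reward_succ (t : ℕ) :
    reward γ π ξ (t + 1)
      = γ (π.act t (trajectory γ π ξ t)) ⬝ᵥ lagVec k (reward γ π ξ) t + ξ (t + 1) := by
  rw [← context_trajectory]; rfl

lemma dotProduct_lagVec (v : Fin (k + 1) → ℝ) (x : ℕ → ℝ) (t : ℕ) :
    v ⬝ᵥ lagVec k x t = v 0 + ∑ i : Fin k, v i.succ * x (t - i) := by
  simp [dotProduct, lagVec, Fin.sum_univ_succ]

lemma totalReward_eq (T : ℕ) :
    totalReward γ π ξ T = ∑ t ∈ Finset.range T, reward γ π ξ (t + 1) := by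
  simp only [totalReward, trajectory_snd]
  exact Fin.sum_univ_eq_sum_range (fun s => reward γ π ξ (s + 1)) T

variable {γ}

lemma abs_sum_lag_le {Γ D : ℝ} (hγ : ∀ a i, 0 ≤ γ a i) (hΓ : ∀ a, ∑ i : Fin k, γ a i.succ ≤ Γ)
    (hD : 0 ≤ D) {x : ℕ → ℝ} {t : ℕ} (hx : ∀ s ≤ t, |x s| ≤ D) (a : Fin n) :
    |∑ i : Fin k, γ a i.succ * x (t - i)| ≤ Γ * D := by
  calc |∑ i : Fin k, γ a i.succ * x (t - i)| ≤ ∑ i : Fin k, |γ a i.succ * x (t - i)| :=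
        Finset.abs_sum_le_sum_abs _ _
    _ ≤ ∑ i : Fin k, γ a i.succ * D := by
        refine Finset.sum_le_sum fun i _ => ?_
        rw [abs_mul, abs_of_nonneg (hγ a _)]
        exact mul_le_mul_of_nonneg_left (hx _ (Nat.sub_le _ _)) (hγ a _)
    _ = (∑ i : Fin k, γ a i.succ) * D := by rw [Finset.sum_mul]
    _ ≤ _ := mul_le_mul_of_nonneg_right (hΓ a) hD

/-- Stability: the rewards are bounded in terms of the noise. -/
lemma abs_reward_le {m Γ S : ℝ} {T : ℕ} (hγ : ∀ a i, 0 ≤ γ a i)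
    (hΓ1 : Γ < 1) (hΓ : ∀ a, ∑ i : Fin k, γ a i.succ ≤ Γ) (hm : ∀ a, γ a 0 ≤ m) (hm0 : 0 ≤ m)
    (hS0 : 0 ≤ S) (hS : ∀ t < T, |ξ (t + 1)| ≤ S) {t : ℕ} (ht : t ≤ T) :
    |reward γ π ξ t| ≤ (m + S) / (1 - Γ) := by
  have h1 : 0 < 1 - Γ := by linarith
  have hD : 0 ≤ (m + S) / (1 - Γ) := by positivity
  induction t using Nat.strong_induction_on with
  | _ t ih =>
    rcases t with _ | t
    · simpa [reward] using hD
    · rw [reward_succ, dotProduct_lagVec]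
      set a := π.act t (trajectory γ π ξ t)
      have e1 := abs_sum_lag_le hγ hΓ hD (x := reward γ π ξ) (t := t)
        (fun s hs => ih s (by omega) (by omega)) a
      have e2 : |γ a 0| ≤ m := by rw [abs_of_nonneg (hγ a 0)]; exact hm a
      have e3 := hS t (by omega)
      -- The bound is the fixed point of D ↦ m + ΓD + S.
      have e4 : m + Γ * ((m + S) / (1 - Γ)) + S = (m + S) / (1 - Γ) := by field_simp; ring
      calc _ ≤ |γ a 0| + |∑ i : Fin k, γ a i.succ * reward γ π ξ (t - i)| + |ξ (t + 1)| :=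
            (abs_add_le _ _).trans (by gcongr; exact abs_add_le _ _)
        _ ≤ _ := by linarith

/-- `g` plays, in every round, an action of maximal conditional expected reward. -/
def IsGreedy {n k : ℕ} (γ : Fin n → Fin (k + 1) → ℝ) (g : Policy n) : Prop :=
  ∀ t (h : History n t) a, γ a ⬝ᵥ context k h ≤ γ (g.act t h) ⬝ᵥ context k h

/-- The instantaneous loss of `π` with respect to the greedy action in the same state. -/
noncomputable def instRegret {n k : ℕ} (γ : Fin n → Fin (k + 1) → ℝ) (g π : Policy n)
    (ξ : ℕ → ℝ) (t : ℕ) : ℝ :=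
  γ (g.act t (trajectory γ π ξ t)) ⬝ᵥ lagVec k (reward γ π ξ) t
    - γ (π.act t (trajectory γ π ξ t)) ⬝ᵥ lagVec k (reward γ π ξ) t

variable {g : Policy n}

lemma instRegret_nonneg (hg : IsGreedy γ g) (t : ℕ) : 0 ≤ instRegret γ g π ξ t := by
  rw [instRegret, ← context_trajectory]
  linarith [hg t (trajectory γ π ξ t) (π.act t (trajectory γ π ξ t))]

/-- In g's state the greedy action beats π's action, and by nonnegativity of the coefficients π's
action earns at least as much on g's larger lags as on π's own. The common noise cancels. -/
lemma reward_le_greedy (hγ : ∀ a i, 0 ≤ γ a i) (hg : IsGreedy γ g) (t : ℕ) :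
    reward γ π ξ t ≤ reward γ g ξ t := by
  induction t using Nat.strong_induction_on with
  | _ t ih =>
    rcases t with _ | t
    · simp [reward]
    · have h := hg t (trajectory γ g ξ t) (π.act t (trajectory γ π ξ t))
      rw [context_trajectory] at h
      rw [reward_succ, reward_succ]
      refine add_le_add_left (le_trans ?_ h) _
      rw [dotProduct_lagVec, dotProduct_lagVec]
      gcongr with i
      · exact hγ _ _
      · exact ih _ (by omega)

/-- Insert the value of g's current action in π's state: changing the state costs the weighted past
gaps, and that value is at most the greedy value there, so the remainder is at most the
instantaneous loss. -/
lemma greedy_sub_reward_succ_le (hg : IsGreedy γ g) (t : ℕ) :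
    reward γ g ξ (t + 1) - reward γ π ξ (t + 1)
      ≤ ∑ i : Fin k, γ (g.act t (trajectory γ g ξ t)) i.succ
          * (reward γ g ξ (t - i) - reward γ π ξ (t - i)) + instRegret γ g π ξ t := by
  have h := hg t (trajectory γ π ξ t) (g.act t (trajectory γ g ξ t))
  rw [context_trajectory] at h
  rw [reward_succ, reward_succ, instRegret]
  have e : ∑ i : Fin k, γ (g.act t (trajectory γ g ξ t)) i.succ
          * (reward γ g ξ (t - i) - reward γ π ξ (t - i))
      = γ (g.act t (trajectory γ g ξ t)) ⬝ᵥ lagVec k (reward γ g ξ) t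
        - γ (g.act t (trajectory γ g ξ t)) ⬝ᵥ lagVec k (reward γ π ξ) t := by
    simp only [dotProduct_lagVec, mul_sub, Finset.sum_sub_distrib]
    ring
  rw [e]
  linarith

/-- The pathwise policy regret is controlled in `ℓ²` by the instantaneous losses. -/
lemma sum_sq_greedy_sub_reward_le {Γ : ℝ} (hγ : ∀ a i, 0 ≤ γ a i) (hΓ0 : 0 ≤ Γ) (hΓ1 : Γ < 1)
    (hΓ : ∀ a, ∑ i : Fin k, γ a i.succ ≤ Γ) (hg : IsGreedy γ g) (T : ℕ) :
    ∑ t ∈ Finset.range T, (reward γ g ξ (t + 1) - reward γ π ξ (t + 1)) ^ 2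
      ≤ (k + 1) / (1 - Γ) ^ 2 * ∑ t ∈ Finset.range T, instRegret γ g π ξ t ^ 2 :=
  sum_sq_le_of_subconvex_recursion hΓ0 hΓ1
    (d := fun t => reward γ g ξ t - reward γ π ξ t)
    (fun t => sub_nonneg.2 (reward_le_greedy π ξ hγ hg t))
    (by simp [reward])
    (fun t i => γ (g.act t (trajectory γ g ξ t)) i.succ) (fun t i => hγ _ _) (fun t => hΓ _)
    (greedy_sub_reward_succ_le π ξ hg)

lemma instRegret_le {m Γ S : ℝ} {T : ℕ} (hγ : ∀ a i, 0 ≤ γ a i)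
    (hΓ1 : Γ < 1) (hΓ : ∀ a, ∑ i : Fin k, γ a i.succ ≤ Γ) (hm : ∀ a, γ a 0 ≤ m) (hm0 : 0 ≤ m)
    (hS0 : 0 ≤ S) (hS : ∀ t < T, |ξ (t + 1)| ≤ S) {t : ℕ} (ht : t < T) :
    instRegret γ g π ξ t ≤ 2 * ((m + S) / (1 - Γ)) := by
  have h1 : 0 < 1 - Γ := by linarith
  have hD : 0 ≤ (m + S) / (1 - Γ) := by positivity
  have hx : ∀ s ≤ t, |reward γ π ξ s| ≤ (m + S) / (1 - Γ) := fun s hs =>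
    abs_reward_le π ξ hγ hΓ1 hΓ hm hm0 hS0 hS (by omega)
  rw [instRegret, dotProduct_lagVec, dotProduct_lagVec]
  have e1 := (abs_le.1 (abs_sum_lag_le hγ hΓ hD hx (g.act t (trajectory γ π ξ t)))).2
  have e2 := (abs_le.1 (abs_sum_lag_le hγ hΓ hD hx (π.act t (trajectory γ π ξ t)))).1
  have e3 := hm (g.act t (trajectory γ π ξ t))
  have e4 := hγ (π.act t (trajectory γ π ξ t)) 0
  have e5 : m + Γ * ((m + S) / (1 - Γ)) + S = (m + S) / (1 - Γ) := by field_simp; ring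
  have e6 : Γ * ((m + S) / (1 - Γ)) ≤ 1 * ((m + S) / (1 - Γ)) :=
    mul_le_mul_of_nonneg_right hΓ1.le hD
  linarith

end

/-! ### Measurability and existence of a greedy policy -/

lemma measurable_context (k n t : ℕ) :
    Measurable (fun h : History n t => context k h) := by
  refine measurable_pi_iff.2 fun j => ?_
  refine Fin.cases ?_ (fun i => ?_) j
  · simp [context]
  · by_cases hi : (i : ℕ) + 1 ≤ t
    · simp only [context, Fin.cons_succ, hi, dif_pos]
      exact (measurable_pi_apply _).snd
    · simp only [context, Fin.cons_succ, hi, dif_neg, not_false_eq_true, measurable_const]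

lemma measurable_dotProduct {α ι : Type*} [MeasurableSpace α] [Fintype ι] {f g : α → ι → ℝ}
    (hf : Measurable f) (hg : Measurable g) : Measurable fun x => f x ⬝ᵥ g x := by
  unfold dotProduct
  exact Finset.measurable_sum _ fun i _ => (measurable_pi_iff.1 hf i).mul (measurable_pi_iff.1 hg i)

/-- Candidates are added one at a time, each replacing the current champion where it is at least as
good; the champion's value stays measurable because the index set is countable. -/
lemma exists_measurable_argmax {α ι : Type*} [MeasurableSpace α] [Countable ι]
    [MeasurableSpace ι] [MeasurableSingletonClass ι] (f : ι → α → ℝ)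
    (hf : ∀ i, Measurable (f i)) {s : Finset ι} (hs : s.Nonempty) :
    ∃ a : α → ι, Measurable a ∧ ∀ x, ∀ i ∈ s, f i x ≤ f (a x) x := by
  classical
  induction hs using Finset.Nonempty.cons_induction with
  | singleton i => exact ⟨fun _ => i, measurable_const, by simp⟩
  | cons i s hi hs ih =>
    obtain ⟨a, ha, h⟩ := ih
    have hfa : Measurable fun x => f (a x) x :=
      (measurable_from_prod_countable_right (f := fun p : ι × α => f p.1 p.2) hf).comp
        (ha.prodMk measurable_id)
    refine ⟨fun x => if f (a x) x ≤ f i x then i else a x,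
      Measurable.ite (measurableSet_le hfa (hf i)) measurable_const ha, fun x j hj => ?_⟩
    show f j x ≤ f (if f (a x) x ≤ f i x then i else a x) x
    rcases Finset.mem_cons.1 hj with rfl | hj
    · split_ifs with hle
      · exact le_rfl
      · exact (not_le.1 hle).le
    · split_ifs with hle
      · exact (h x j hj).trans hle
      · exact h x j hj

lemma exists_isGreedy {n k : ℕ} (hn : 1 ≤ n) (γ : Fin n → Fin (k + 1) → ℝ) :
    ∃ g : Policy n, IsGreedy γ g := by
  have : Nonempty (Fin n) := ⟨⟨0, hn⟩⟩
  have h := fun t => exists_measurable_argmax (fun a (h : History n t) => γ a ⬝ᵥ context k h)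
    (fun a => measurable_dotProduct measurable_const (measurable_context k n t))
    (Finset.univ_nonempty (α := Fin n))
  choose act hact hmax using h
  exact ⟨⟨act, hact⟩, fun t h a => hmax t h a (Finset.mem_univ a)⟩

/-- The history of the first `t` rounds is determined by the noise of these rounds. -/
lemma measurable_trajectory {Ω : Type*} {mΩ : MeasurableSpace Ω} {ℱ : Filtration ℕ mΩ}
    {ξ : ℕ → Ω → ℝ} (hξ : ∀ t, Measurable[ℱ (t + 1)] (ξ (t + 1))) {n k : ℕ}
    (γ : Fin n → Fin (k + 1) → ℝ) (π : Policy n) (t : ℕ) :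
    Measurable[ℱ t] fun ω => trajectory γ π (fun s => ξ s ω) t := by
  induction t with
  | zero =>
    refine (@measurable_pi_iff _ _ _ (ℱ 0) _ _).2 fun s => s.elim0
  | succ t ih =>
    have ih' : Measurable[ℱ (t + 1)] fun ω => trajectory γ π (fun s => ξ s ω) t :=
      ih.mono (ℱ.mono (Nat.le_succ t)) le_rfl
    let _ := ℱ (t + 1)
    refine measurable_pi_iff.2 fun s => ?_
    refine Fin.lastCases ?_ (fun i => ?_) s
    · have hact := (π.measurable_act t).comp ih'
      simp only [trajectory_succ_last, reward]
      refine hact.prodMk (Measurable.add ?_ (hξ t))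
      refine measurable_dotProduct ?_ ((measurable_context k n t).comp ih')
      exact (measurable_of_countable γ).comp hact
    · simp only [trajectory_succ_castSucc]
      exact (measurable_pi_apply i).comp ih'
/-! ### Rank-one updates of positive definite matrices -/

section

variable {ι : Type*} [Fintype ι]

lemma dotProduct_mulVec_symm {A : Matrix ι ι ℝ} (hA : A.IsHermitian) (x y : ι → ℝ) :
    x ⬝ᵥ A *ᵥ y = y ⬝ᵥ A *ᵥ x := by
  have h : Aᵀ = A := by rw [← Matrix.conjTranspose_eq_transpose_of_trivial]; exact hA
  rw [Matrix.dotProduct_mulVec, ← Matrix.mulVec_transpose, h, dotProduct_comm]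

lemma posSemidef_sq_le {A : Matrix ι ι ℝ} (hA : A.PosSemidef) (x y : ι → ℝ) :
    (x ⬝ᵥ A *ᵥ y) ^ 2 ≤ (x ⬝ᵥ A *ᵥ x) * (y ⬝ᵥ A *ᵥ y) := by
  have h : ∀ s : ℝ, 0 ≤ (y ⬝ᵥ A *ᵥ y) * (s * s) + (2 * (x ⬝ᵥ A *ᵥ y)) * s + x ⬝ᵥ A *ᵥ x := by
    intro s
    have h := hA.dotProduct_mulVec_nonneg (x + s • y)
    simp only [star_trivial, Matrix.mulVec_add, Matrix.mulVec_smul, dotProduct_add, add_dotProduct,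
      smul_dotProduct, dotProduct_smul, smul_eq_mul] at h
    rw [dotProduct_mulVec_symm hA.1 y x] at h
    linarith
  have := discrim_le_zero h
  rw [discrim] at this
  linarith

variable {V : Matrix ι ι ℝ}

lemma posDef_add_vecMulVec (hV : V.PosDef) (z : ι → ℝ) :
    (V + Matrix.vecMulVec z z).PosDef :=
  hV.add_posSemidef (by simpa using Matrix.posSemidef_vecMulVec_self_star z)

variable [DecidableEq ι]

lemma isUnit_det_of_posDef (hV : V.PosDef) : IsUnit V.det := hV.det_pos.ne'.isUnit

lemma inv_quadratic_nonneg (hV : V.PosDef) (x : ι → ℝ) : 0 ≤ x ⬝ᵥ V⁻¹ *ᵥ x := by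
  simpa using hV.inv.posSemidef.dotProduct_mulVec_nonneg x

lemma inv_mulVec_eq (hV : V.PosDef) {x y : ι → ℝ} (h : V *ᵥ x = y) : V⁻¹ *ᵥ y = x := by
  rw [← h, Matrix.mulVec_mulVec, Matrix.nonsing_inv_mul _ (isUnit_det_of_posDef hV),
    Matrix.one_mulVec]

lemma mulVec_inv_mulVec (hV : V.PosDef) (x : ι → ℝ) : V *ᵥ (V⁻¹ *ᵥ x) = x := by
  rw [Matrix.mulVec_mulVec, Matrix.mul_nonsing_inv _ (isUnit_det_of_posDef hV), Matrix.one_mulVec]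

/-- The matrix determinant lemma. -/
lemma det_add_vecMulVec (hV : V.PosDef) (z : ι → ℝ) :
    (V + Matrix.vecMulVec z z).det = V.det * (1 + z ⬝ᵥ V⁻¹ *ᵥ z) := by
  rw [Matrix.vecMulVec_eq Unit, Matrix.det_add_replicateCol_mul_replicateRow
    (isUnit_det_of_posDef hV)]
  congr 1
  rw [Matrix.det_unique]
  simp only [Matrix.add_apply, Matrix.one_apply_eq, Matrix.mul_assoc]
  congr 1

/-- The Sherman–Morrison formula, verified by applying the updated matrix to the right-hand side. -/
lemma inv_add_vecMulVec_mulVec (hV : V.PosDef) (z y : ι → ℝ) :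
    (V + Matrix.vecMulVec z z)⁻¹ *ᵥ y
      = V⁻¹ *ᵥ y - ((z ⬝ᵥ V⁻¹ *ᵥ y) / (1 + z ⬝ᵥ V⁻¹ *ᵥ z)) • (V⁻¹ *ᵥ z) := by
  have hw := inv_quadratic_nonneg hV z
  refine inv_mulVec_eq (posDef_add_vecMulVec hV z) ?_
  simp only [Matrix.add_mulVec, Matrix.mulVec_sub, Matrix.mulVec_smul, mulVec_inv_mulVec hV,
    Matrix.vecMulVec_mulVec]
  funext i
  simp only [Pi.add_apply, Pi.sub_apply, Pi.smul_apply, smul_eq_mul, MulOpposite.smul_eq_mul_unop,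
    MulOpposite.unop_op]
  field_simp
  ring

/-- The self-normalized quadratic form after a rank-one update. -/
lemma inv_quadratic_update (hV : V.PosDef) (z S : ι → ℝ) (e : ℝ) :
    (S + e • z) ⬝ᵥ (V + Matrix.vecMulVec z z)⁻¹ *ᵥ (S + e • z)
      = S ⬝ᵥ V⁻¹ *ᵥ S
        + (2 * e * (z ⬝ᵥ V⁻¹ *ᵥ S) + e ^ 2 * (z ⬝ᵥ V⁻¹ *ᵥ z) - (z ⬝ᵥ V⁻¹ *ᵥ S) ^ 2)
          / (1 + z ⬝ᵥ V⁻¹ *ᵥ z) := by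
  have hw := inv_quadratic_nonneg hV z
  rw [inv_add_vecMulVec_mulVec hV]
  simp only [Matrix.mulVec_add, Matrix.mulVec_smul, dotProduct_add, add_dotProduct, dotProduct_sub,
      smul_dotProduct, dotProduct_smul, smul_eq_mul]
  rw [dotProduct_mulVec_symm hV.inv.1 S z]
  field_simp
  ring

lemma lam_mul_inv_quadratic_le {lam : ℝ} (hlam : 0 ≤ lam) (hV : V.PosDef)
    (h : ∀ y, lam * (y ⬝ᵥ y) ≤ y ⬝ᵥ V *ᵥ y) (x : ι → ℝ) : lam * (x ⬝ᵥ V⁻¹ *ᵥ x) ≤ x ⬝ᵥ x := by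
  set y := V⁻¹ *ᵥ x with hy
  have h1 : lam * (y ⬝ᵥ y) ≤ x ⬝ᵥ y := by
    have := h y
    rwa [hy, mulVec_inv_mulVec hV, dotProduct_comm _ x] at this
  have hyy : 0 ≤ y ⬝ᵥ y := by simpa using dotProduct_star_self_nonneg y
  have h2 : (x ⬝ᵥ y) ^ 2 ≤ (x ⬝ᵥ x) * (y ⬝ᵥ y) := by
    have := posSemidef_sq_le (A := (1 : Matrix ι ι ℝ)) Matrix.PosSemidef.one x y
    simpa using this
  rcases (inv_quadratic_nonneg hV x).eq_or_lt with h0 | h0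
  · rw [← hy] at h0
    rw [← h0, mul_zero]
    simpa using dotProduct_star_self_nonneg x
  · rw [← hy] at h0
    have hxx : 0 ≤ x ⬝ᵥ x := by simpa using dotProduct_star_self_nonneg x
    -- With y = V⁻¹x: λ(x·y)² ≤ λ|x|²|y|² ≤ |x|²(x·y), after which the positive factor x·y is
    -- cancelled.
    have : lam * (x ⬝ᵥ y) * (x ⬝ᵥ y) ≤ (x ⬝ᵥ x) * (x ⬝ᵥ y) := by nlinarith
    exact le_of_mul_le_mul_right this h0

/-- Each eigenvalue is at most the trace. Omitting the AM-GM normalization only adds a factor k + 1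
inside a logarithm later. -/
lemma det_le_trace_pow (hV : V.PosSemidef) : V.det ≤ V.trace ^ Fintype.card ι := by
  have h1 := hV.1.det_eq_prod_eigenvalues
  have h2 := hV.1.trace_eq_sum_eigenvalues
  simp only [RCLike.ofReal_real_eq_id, id] at h1 h2
  rw [h1, h2, ← Finset.card_univ]
  refine (Finset.prod_le_prod (fun i _ => hV.eigenvalues_nonneg i) fun i _ => ?_).trans_eq
    (Finset.prod_const _)
  exact Finset.single_le_sum (fun j _ => hV.eigenvalues_nonneg j) (Finset.mem_univ i)

end
/-! ### The ridge regression of AR-UCB along a trajectory -/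

section

variable {n k : ℕ} (γ : Fin n → Fin (k + 1) → ℝ) (π : Policy n) (ξ : ℕ → ℝ) (lam : ℝ)

/-- The action played in round `t + 1`. -/
def played (t : ℕ) : Fin n := π.act t (trajectory γ π ξ t)

/-- The context vector of round `t + 1` if `a` is played in that round, and `0` otherwise. -/
noncomputable def selVec (t : ℕ) (a : Fin n) : Fin (k + 1) → ℝ :=
  if a = played γ π ξ t then context k (trajectory γ π ξ t) else 0

/-- The Gram matrix of action `a` along the trajectory. -/
noncomputable def gramPath (t : ℕ) (a : Fin n) : Matrix (Fin (k + 1)) (Fin (k + 1)) ℝ :=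
  gram k lam t (trajectory γ π ξ t) a

/-- The noise accumulated in the response vector of action `a`. -/
noncomputable def noiseVec : ℕ → Fin n → Fin (k + 1) → ℝ
  | 0, _ => 0
  | t + 1, a => noiseVec t a + ξ (t + 1) • selVec γ π ξ t a

/-- The logarithm of the normalized determinant of the Gram matrix. -/
noncomputable def logDet (t : ℕ) (a : Fin n) : ℝ :=
  Real.log ((gramPath γ π ξ lam t a).det / lam ^ (k + 1))

lemma gramPath_zero (a : Fin n) : gramPath γ π ξ lam 0 a = lam • 1 := rfl

lemma trajectory_castSucc_eq (t : ℕ) :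
    (fun i : Fin t => trajectory γ π ξ (t + 1) i.castSucc) = trajectory γ π ξ t :=
  funext fun i => trajectory_succ_castSucc γ π ξ t i

lemma gramPath_succ (t : ℕ) (a : Fin n) :
    gramPath γ π ξ lam (t + 1) a = gramPath γ π ξ lam t a
      + Matrix.vecMulVec (selVec γ π ξ t a) (selVec γ π ξ t a) := by
  simp only [gramPath, gram, trajectory_castSucc_eq, trajectory_succ_last, selVec, played]
  split_ifs with h <;> simp [h]

lemma gramPath_posDef (hlam : 0 < lam) (t : ℕ) (a : Fin n) :
    (gramPath γ π ξ lam t a).PosDef := by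
  induction t with
  | zero => rw [gramPath_zero]; exact Matrix.PosDef.one.smul hlam
  | succ t ih => rw [gramPath_succ]; exact posDef_add_vecMulVec ih _

lemma lam_le_gramPath (t : ℕ) (a : Fin n) (y : Fin (k + 1) → ℝ) :
    lam * (y ⬝ᵥ y) ≤ y ⬝ᵥ gramPath γ π ξ lam t a *ᵥ y := by
  induction t with
  | zero => simp [gramPath_zero, Matrix.smul_mulVec]
  | succ t ih =>
    rw [gramPath_succ, Matrix.add_mulVec, dotProduct_add, Matrix.vecMulVec_mulVec]
    have : 0 ≤ y ⬝ᵥ MulOpposite.op (selVec γ π ξ t a ⬝ᵥ y) • selVec γ π ξ t a := by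
      rw [dotProduct_smul, dotProduct_comm y]
      exact mul_self_nonneg _
    linarith

/-- Substituting the reward model shows that the ridge estimate errs only through the regularization
term and the accumulated noise. -/
lemma responseVec_trajectory (t : ℕ) (a : Fin n) :
    responseVec k t (trajectory γ π ξ t) a
      = gramPath γ π ξ lam t a *ᵥ γ a - lam • γ a + noiseVec γ π ξ t a := by
  induction t with
  | zero => simp [responseVec, gramPath_zero, noiseVec, Matrix.smul_mulVec]
  | succ t ih =>
    rw [gramPath_succ, Matrix.add_mulVec, Matrix.vecMulVec_mulVec, noiseVec]
    simp only [responseVec, trajectory_castSucc_eq, trajectory_succ_last, ih, selVec, played, reward]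
    by_cases h : a = π.act t (trajectory γ π ξ t)
    · subst h
      simp only [if_true]
      funext i
      simp only [Pi.add_apply, Pi.sub_apply, Pi.smul_apply, smul_eq_mul,
        MulOpposite.smul_eq_mul_unop, MulOpposite.unop_op]
      rw [dotProduct_comm (γ _)]
      ring
    · simp [h]

/-- The event that the noise in the regression of every action is within its confidence radius. -/
def Concentrated (σ δ : ℝ) (t : ℕ) : Prop :=
  ∀ a, noiseVec γ π ξ t a ⬝ᵥ (gramPath γ π ξ lam t a)⁻¹ *ᵥ noiseVec γ π ξ t a
    ≤ σ ^ 2 * (2 * Real.log (n / δ) + logDet γ π ξ lam t a)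

lemma det_gramPath_succ (hlam : 0 < lam) (t : ℕ) (a : Fin n) :
    (gramPath γ π ξ lam (t + 1) a).det = (gramPath γ π ξ lam t a).det
      * (1 + selVec γ π ξ t a ⬝ᵥ (gramPath γ π ξ lam t a)⁻¹ *ᵥ selVec γ π ξ t a) := by
  rw [gramPath_succ, det_add_vecMulVec (gramPath_posDef γ π ξ lam hlam t a)]

lemma logDet_zero (hlam : 0 < lam) (a : Fin n) : logDet γ π ξ lam 0 a = 0 := by
  simp [logDet, gramPath_zero, hlam.ne']

lemma logDet_succ (hlam : 0 < lam) (t : ℕ) (a : Fin n) :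
    logDet γ π ξ lam (t + 1) a = logDet γ π ξ lam t a
      + Real.log (1 + selVec γ π ξ t a ⬝ᵥ (gramPath γ π ξ lam t a)⁻¹ *ᵥ selVec γ π ξ t a) := by
  have hV := gramPath_posDef γ π ξ lam hlam t a
  have h1 := hV.det_pos
  have h2 := inv_quadratic_nonneg hV (selVec γ π ξ t a)
  rw [logDet, logDet, det_gramPath_succ γ π ξ lam hlam, ← Real.log_mul (by positivity) (by positivity)]
  congr 1
  ring

lemma logDet_nonneg (hlam : 0 < lam) (t : ℕ) (a : Fin n) : 0 ≤ logDet γ π ξ lam t a := by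
  induction t with
  | zero => rw [logDet_zero γ π ξ lam hlam]
  | succ t ih =>
    rw [logDet_succ γ π ξ lam hlam]
    have h2 := inv_quadratic_nonneg (gramPath_posDef γ π ξ lam hlam t a) (selVec γ π ξ t a)
    exact add_nonneg ih (Real.log_nonneg (by linarith))

/-- The squared width of the confidence interval of the action played in round `t + 1`. -/
noncomputable def sqWidth (t : ℕ) : ℝ :=
  context k (trajectory γ π ξ t) ⬝ᵥ
    (gramPath γ π ξ lam t (played γ π ξ t))⁻¹ *ᵥ context k (trajectory γ π ξ t)

lemma min_one_le_two_mul_log {x : ℝ} (hx : 0 ≤ x) : min 1 x ≤ 2 * Real.log (1 + x) := by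
  have h := Real.le_log_one_add_of_nonneg hx
  have h2 : min 1 x / 2 ≤ 2 * x / (x + 2) := by
    rw [div_le_div_iff₀ (by norm_num) (by linarith)]
    rcases le_total x 1 with h1 | h1
    · rw [min_eq_right h1]; nlinarith
    · rw [min_eq_left h1]; nlinarith
  linarith

/-- The elliptical potential lemma, summed over the actions. -/
lemma sum_min_one_sqWidth_le (hlam : 0 < lam) (T : ℕ) :
    ∑ t ∈ Finset.range T, min 1 (sqWidth γ π ξ lam t) ≤ 2 * ∑ a, logDet γ π ξ lam T a := by
  induction T with
  | zero => simp [logDet_zero γ π ξ lam hlam]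
  | succ T ih =>
    rw [Finset.sum_range_succ]
    -- Only the determinant of the played action changes.
    have e : ∑ a, logDet γ π ξ lam (T + 1) a
        = ∑ a, logDet γ π ξ lam T a + Real.log (1 + sqWidth γ π ξ lam T) := by
      simp only [logDet_succ γ π ξ lam hlam, Finset.sum_add_distrib]
      congr 1
      rw [Finset.sum_eq_single (played γ π ξ T)]
      · simp [selVec, sqWidth]
      · intro a _ ha; simp [selVec, ha]
      · simp
    have := min_one_le_two_mul_log
      (inv_quadratic_nonneg (gramPath_posDef γ π ξ lam hlam T (played γ π ξ T))
        (context k (trajectory γ π ξ T)))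
    rw [e]
    change min 1 (sqWidth γ π ξ lam T) ≤ _ at this
    change _ ≤ 2 * Real.log (1 + sqWidth γ π ξ lam T) at this
    linarith

lemma trace_gramPath_le {D : ℝ} {T : ℕ}
    (hD : ∀ t ≤ T, |reward γ π ξ t| ≤ D) {t : ℕ} (ht : t ≤ T) (a : Fin n) :
    (gramPath γ π ξ lam t a).trace ≤ (k + 1) * (lam + t * (1 + D ^ 2)) := by
  induction t with
  | zero => simp [gramPath_zero, mul_comm]
  | succ t ih =>
    rw [gramPath_succ, Matrix.trace_add, Matrix.trace_vecMulVec]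
    have h1 := ih (by omega)
    have h2 : selVec γ π ξ t a ⬝ᵥ selVec γ π ξ t a ≤ (k + 1) * (1 + D ^ 2) := by
      rw [selVec]
      split_ifs
      · rw [context_trajectory, dotProduct_lagVec]
        have : ∑ i : Fin k, lagVec k (reward γ π ξ) t i.succ * reward γ π ξ (t - i)
            ≤ ∑ i : Fin k, (1 + D ^ 2) := by
          refine Finset.sum_le_sum fun i _ => ?_
          have := hD (t - i) (by omega)
          have h3 : reward γ π ξ (t - i) ^ 2 ≤ D ^ 2 := by
            rw [← sq_abs]; exact pow_le_pow_left₀ (abs_nonneg _) this 2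
          simp only [lagVec, Fin.cons_succ]
          nlinarith
        simp only [Finset.sum_const, Finset.card_univ, Fintype.card_fin, nsmul_eq_mul] at this
        have h0 : lagVec k (reward γ π ξ) t 0 = 1 := rfl
        rw [h0]
        nlinarith [sq_nonneg D]
      · simp only [dotProduct_zero]; positivity
    push_cast
    linarith

lemma logDet_le {D : ℝ} {T : ℕ} (hlam : 0 < lam)
    (hD : ∀ t ≤ T, |reward γ π ξ t| ≤ D) {t : ℕ} (ht : t ≤ T) (a : Fin n) :
    logDet γ π ξ lam t a ≤ (k + 1) * Real.log ((k + 1) * (1 + T * (1 + D ^ 2) / lam)) := by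
  have hV := gramPath_posDef γ π ξ lam hlam t a
  have h1 := det_le_trace_pow hV.posSemidef
  rw [Fintype.card_fin] at h1
  have h2 := trace_gramPath_le γ π ξ lam hD ht a
  have ht' : (t : ℝ) ≤ T := by exact_mod_cast ht
  have h3 : (gramPath γ π ξ lam t a).det / lam ^ (k + 1)
      ≤ ((k + 1) * (1 + T * (1 + D ^ 2) / lam)) ^ (k + 1) := by
    rw [div_le_iff₀ (by positivity), ← mul_pow]
    refine h1.trans (pow_le_pow_left₀ hV.posSemidef.trace_nonneg (h2.trans ?_) _)
    have : ((k : ℝ) + 1) * (1 + T * (1 + D ^ 2) / lam) * lam = (k + 1) * (lam + T * (1 + D ^ 2)) := by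
      field_simp
    rw [this]
    gcongr
  have h4 : 0 < (gramPath γ π ξ lam t a).det / lam ^ (k + 1) := div_pos hV.det_pos (by positivity)
  calc logDet γ π ξ lam t a ≤ Real.log (((k + 1) * (1 + T * (1 + D ^ 2) / lam)) ^ (k + 1)) :=
        Real.log_le_log h4 h3
    _ = _ := by rw [Real.log_pow]; push_cast; ring

variable {γ lam}

lemma dotProduct_self_param_le {m Γ : ℝ} (hγ : ∀ a i, 0 ≤ γ a i) (hΓ1 : Γ < 1)
    (hΓ : ∀ a, ∑ i : Fin k, γ a i.succ ≤ Γ) (hm : ∀ a, γ a 0 ≤ m) (a : Fin n) :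
    γ a ⬝ᵥ γ a ≤ m ^ 2 + 1 := by
  rw [dotProduct, Fin.sum_univ_succ, ← pow_two]
  refine add_le_add (pow_le_pow_left₀ (hγ a 0) (hm a) 2) ?_
  have h1 : ∀ i : Fin k, γ a i.succ ≤ 1 := fun i =>
    ((Finset.single_le_sum (fun j _ => hγ a (Fin.succ j)) (Finset.mem_univ i)).trans (hΓ a)).trans
      hΓ1.le
  calc ∑ i : Fin k, γ a i.succ * γ a i.succ ≤ ∑ i : Fin k, γ a i.succ :=
        Finset.sum_le_sum fun i _ => mul_le_of_le_one_right (hγ a _) (h1 i)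
    _ ≤ 1 := (hΓ a).trans hΓ1.le

/-- On the concentration event the index of every action is a valid confidence bound. -/
lemma abs_estimate_sub_le {m σ δ Γ : ℝ} (hlam : 0 < lam) (hσ : 0 ≤ σ) (hγ : ∀ a i, 0 ≤ γ a i)
    (hΓ1 : Γ < 1) (hΓ : ∀ a, ∑ i : Fin k, γ a i.succ ≤ Γ) (hm : ∀ a, γ a 0 ≤ m) {t : ℕ}
    (hC : Concentrated γ π ξ lam σ δ t) (a : Fin n) (z : Fin (k + 1) → ℝ) :
    |estimate k lam (trajectory γ π ξ t) a ⬝ᵥ z - γ a ⬝ᵥ z|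
      ≤ explorationCoeff k lam m σ δ (trajectory γ π ξ t) a
        * √(z ⬝ᵥ (gramPath γ π ξ lam t a)⁻¹ *ᵥ z) := by
  set V := gramPath γ π ξ lam t a with hVdef
  have hV : V.PosDef := gramPath_posDef γ π ξ lam hlam t a
  set S := noiseVec γ π ξ t a with hS
  have e : estimate k lam (trajectory γ π ξ t) a ⬝ᵥ z - γ a ⬝ᵥ z
      = S ⬝ᵥ V⁻¹ *ᵥ z - lam * (γ a ⬝ᵥ V⁻¹ *ᵥ z) := by
    have h1 : estimate k lam (trajectory γ π ξ t) a = γ a - lam • (V⁻¹ *ᵥ γ a) + V⁻¹ *ᵥ S := by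
      rw [estimate, responseVec_trajectory γ π ξ lam, Matrix.mulVec_add, Matrix.mulVec_sub,
        Matrix.mulVec_smul]
      congr 2
      exact inv_mulVec_eq hV rfl
    rw [h1, add_dotProduct, sub_dotProduct, smul_dotProduct, smul_eq_mul,
      dotProduct_comm (V⁻¹ *ᵥ γ a), dotProduct_comm (V⁻¹ *ᵥ S),
      dotProduct_mulVec_symm hV.inv.1 z, dotProduct_mulVec_symm hV.inv.1 z]
    ring
  have cs : ∀ y : Fin (k + 1) → ℝ, |y ⬝ᵥ V⁻¹ *ᵥ z| ≤ √(y ⬝ᵥ V⁻¹ *ᵥ y) * √(z ⬝ᵥ V⁻¹ *ᵥ z) := by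
    intro y
    rw [← Real.sqrt_mul (inv_quadratic_nonneg hV y)]
    exact Real.abs_le_sqrt (posSemidef_sq_le hV.inv.posSemidef y z)
  have h1 : √(S ⬝ᵥ V⁻¹ *ᵥ S) ≤ σ * √(2 * Real.log (n / δ) + logDet γ π ξ lam t a) := by
    refine (Real.sqrt_le_sqrt (hC a)).trans_eq ?_
    rw [Real.sqrt_mul (sq_nonneg σ), Real.sqrt_sq hσ]
  -- The regularization bias: λV⁻¹ ≤ I because V ≥ λI, and |γ(a)|² ≤ m² + 1.
  have h2 : lam * √(γ a ⬝ᵥ V⁻¹ *ᵥ γ a) ≤ √(lam * (m ^ 2 + 1)) := by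
    refine Real.le_sqrt_of_sq_le ?_
    rw [mul_pow, Real.sq_sqrt (inv_quadratic_nonneg hV _)]
    have h3 := lam_mul_inv_quadratic_le hlam.le hV (lam_le_gramPath γ π ξ lam t a) (γ a)
    have h4 := dotProduct_self_param_le hγ hΓ1 hΓ hm a
    nlinarith
  rw [e]
  have hw := Real.sqrt_nonneg (z ⬝ᵥ V⁻¹ *ᵥ z)
  calc |S ⬝ᵥ V⁻¹ *ᵥ z - lam * (γ a ⬝ᵥ V⁻¹ *ᵥ z)|
      ≤ |S ⬝ᵥ V⁻¹ *ᵥ z| + lam * |γ a ⬝ᵥ V⁻¹ *ᵥ z| := by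
        refine (abs_sub _ _).trans_eq ?_
        rw [abs_mul, abs_of_pos hlam]
    _ ≤ √(S ⬝ᵥ V⁻¹ *ᵥ S) * √(z ⬝ᵥ V⁻¹ *ᵥ z)
        + lam * (√(γ a ⬝ᵥ V⁻¹ *ᵥ γ a) * √(z ⬝ᵥ V⁻¹ *ᵥ z)) :=
        add_le_add (cs S) (mul_le_mul_of_nonneg_left (cs _) hlam.le)
    _ = (lam * √(γ a ⬝ᵥ V⁻¹ *ᵥ γ a) + √(S ⬝ᵥ V⁻¹ *ᵥ S)) * √(z ⬝ᵥ V⁻¹ *ᵥ z) := by ring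
    _ ≤ (√(lam * (m ^ 2 + 1)) + σ * √(2 * Real.log (n / δ) + logDet γ π ξ lam t a))
        * √(z ⬝ᵥ V⁻¹ *ᵥ z) := by gcongr

variable {π} {g : Policy n}

/-- Optimism: the greedy value is at most the greedy action's index, hence at most the played
action's index, which exceeds the played action's true value by at most twice its radius. -/
lemma instRegret_le_width {m σ δ Γ : ℝ} {T : ℕ} (hlam : 0 < lam) (hσ : 0 ≤ σ)
    (hγ : ∀ a i, 0 ≤ γ a i) (hΓ1 : Γ < 1) (hΓ : ∀ a, ∑ i : Fin k, γ a i.succ ≤ Γ)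
    (hm : ∀ a, γ a 0 ≤ m) (hπ : IsARUCB k lam m σ δ T π) {t : ℕ} (ht : t < T)
    (hC : Concentrated γ π ξ lam σ δ t) :
    instRegret γ g π ξ t
      ≤ 2 * (explorationCoeff k lam m σ δ (trajectory γ π ξ t) (played γ π ξ t)
        * √(sqWidth γ π ξ lam t)) := by
  have h := hπ t ht (trajectory γ π ξ t) (g.act t (trajectory γ π ξ t))
  have h1 := (abs_le.1 (abs_estimate_sub_le π ξ hlam hσ hγ hΓ1 hΓ hm hC
    (g.act t (trajectory γ π ξ t)) (context k (trajectory γ π ξ t)))).1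
  have h2 := (abs_le.1 (abs_estimate_sub_le π ξ hlam hσ hγ hΓ1 hΓ hm hC
    (played γ π ξ t) (context k (trajectory γ π ξ t)))).2
  rw [instRegret, ← context_trajectory]
  simp only [ucb] at h
  simp only [sqWidth, played, gramPath] at *
  linarith

/-- The pathwise bound on the instantaneous losses of AR-UCB; `b` counts the rounds in which the
concentration event fails. -/
lemma sum_sq_instRegret_le {m σ δ Γ S D ℓ : ℝ} {T : ℕ} (hlam : 0 < lam) (hσ : 0 ≤ σ)
    (hγ : ∀ a i, 0 ≤ γ a i) (hΓ1 : Γ < 1) (hΓ : ∀ a, ∑ i : Fin k, γ a i.succ ≤ Γ)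
    (hm : ∀ a, γ a 0 ≤ m) (hm0 : 0 ≤ m) (hS0 : 0 ≤ S) (hS : ∀ t < T, |ξ (t + 1)| ≤ S)
    (hDdef : D = (m + S) / (1 - Γ)) (hℓ : ℓ = Real.log ((k + 1) * (1 + T * (1 + D ^ 2) / lam)))
    (hδ : 0 ≤ Real.log (n / δ)) (hg : IsGreedy γ g) (hπ : IsARUCB k lam m σ δ T π)
    {b : ℕ → ℝ} (hb0 : ∀ t, 0 ≤ b t) (hb : ∀ t, ¬ Concentrated γ π ξ lam σ δ t → 1 ≤ b t) :
    ∑ t ∈ Finset.range T, instRegret γ g π ξ t ^ 2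
      ≤ 4 * (D ^ 2 + (2 * (lam * (m ^ 2 + 1))
          + 2 * (σ ^ 2 * (2 * Real.log (n / δ) + (k + 1) * ℓ)))) * (2 * (n * ((k + 1) * ℓ)))
        + ∑ t ∈ Finset.range T, 4 * D ^ 2 * b t := by
  have hDx : ∀ t ≤ T, |reward γ π ξ t| ≤ D := fun t ht => by
    rw [hDdef]; exact abs_reward_le π ξ hγ hΓ1 hΓ hm hm0 hS0 hS ht
  have hld : ∀ t ≤ T, ∀ a, logDet γ π ξ lam t a ≤ (k + 1) * ℓ := fun t ht a => by
    rw [hℓ]; exact logDet_le γ π ξ lam hlam hDx ht a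
  -- `K` dominates both D² and β², so the trivial bound and the width bound merge into 4K min(1,
  -- w²).
  set K := D ^ 2 + (2 * (lam * (m ^ 2 + 1))
          + 2 * (σ ^ 2 * (2 * Real.log (n / δ) + (k + 1) * ℓ))) with hK
  have hD0 : 0 ≤ D := (abs_nonneg _).trans (hDx 0 (Nat.zero_le _))
  have hkl : 0 ≤ (k + 1) * ℓ := by
    have : (1 : ℝ) ≤ (k + 1) * (1 + T * (1 + D ^ 2) / lam) := by
      have h1 : (0 : ℝ) ≤ T * (1 + D ^ 2) / lam := by positivity
      have h2 : (0 : ℝ) ≤ k := by positivity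
      nlinarith
    have := Real.log_nonneg this
    rw [← hℓ] at this
    positivity
  have hpt : ∀ t < T, instRegret γ g π ξ t ^ 2
      ≤ 4 * K * min 1 (sqWidth γ π ξ lam t) + 4 * D ^ 2 * b t := by
    intro t ht
    have hr0 := instRegret_nonneg (γ := γ) π ξ hg t
    have hrD : instRegret γ g π ξ t ≤ 2 * D := by
      rw [hDdef]; exact instRegret_le π ξ hγ hΓ1 hΓ hm hm0 hS0 hS ht
    have hrD2 : instRegret γ g π ξ t ^ 2 ≤ 4 * D ^ 2 := by nlinarith
    have hw0 : 0 ≤ sqWidth γ π ξ lam t := inv_quadratic_nonneg (gramPath_posDef γ π ξ lam hlam t _) _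
    have hK0 : D ^ 2 ≤ K := by
      rw [hK]
      have : 0 ≤ σ ^ 2 * (2 * Real.log (n / δ) + (k + 1) * ℓ) := by positivity
      have : 0 ≤ lam * (m ^ 2 + 1) := by positivity
      linarith
    have hK00 : 0 ≤ K := (sq_nonneg D).trans hK0
    have hb0t := hb0 t
    by_cases hC : Concentrated γ π ξ lam σ δ t
    · have hr := instRegret_le_width ξ (g := g) hlam hσ hγ hΓ1 hΓ hm hπ ht hC
      set β := explorationCoeff k lam m σ δ (trajectory γ π ξ t) (played γ π ξ t) with hβ
      have hβ2 : β ^ 2 ≤ K := by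
        have h0 : β = √(lam * (m ^ 2 + 1))
          + σ * √(2 * Real.log (n / δ) + logDet γ π ξ lam t (played γ π ξ t)) := rfl
        have h1 := Real.sq_sqrt (show 0 ≤ lam * (m ^ 2 + 1) by positivity)
        have h2 := Real.sq_sqrt (show 0 ≤ 2 * Real.log (n / δ)
          + logDet γ π ξ lam t (played γ π ξ t) by
            have := logDet_nonneg γ π ξ lam hlam t (played γ π ξ t); positivity)
        have h3 := hld t ht.le (played γ π ξ t)
        have h4 : (σ * √(2 * Real.log (n / δ) + logDet γ π ξ lam t (played γ π ξ t))) ^ 2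
            ≤ σ ^ 2 * (2 * Real.log (n / δ) + (k + 1) * ℓ) := by
          rw [mul_pow, h2]; gcongr
        have h5 := add_sq_le (a := √(lam * (m ^ 2 + 1)))
          (b := σ * √(2 * Real.log (n / δ) + logDet γ π ξ lam t (played γ π ξ t)))
        rw [h0, hK]
        nlinarith [sq_nonneg D]
      have hr2 : instRegret γ g π ξ t ^ 2 ≤ 4 * K * sqWidth γ π ξ lam t := by
        calc _ ≤ (2 * (β * √(sqWidth γ π ξ lam t))) ^ 2 := pow_le_pow_left₀ hr0 hr 2
          _ = 4 * β ^ 2 * sqWidth γ π ξ lam t := by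
            rw [mul_pow, mul_pow, Real.sq_sqrt hw0]; ring
          _ ≤ _ := by gcongr
      have : instRegret γ g π ξ t ^ 2 ≤ 4 * K * min 1 (sqWidth γ π ξ lam t) := by
        rcases le_total 1 (sqWidth γ π ξ lam t) with h1 | h1
        · rw [min_eq_left h1]; linarith
        · rw [min_eq_right h1]; exact hr2
      have : 0 ≤ 4 * D ^ 2 * b t := by positivity
      linarith
    · have h1 := hb t hC
      have : 4 * D ^ 2 * 1 ≤ 4 * D ^ 2 * b t := by gcongr
      have : 0 ≤ 4 * K * min 1 (sqWidth γ π ξ lam t) :=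
        mul_nonneg (by linarith) (le_min zero_le_one hw0)
      linarith
  have hK00 : 0 ≤ K := by
    have : 0 ≤ σ ^ 2 * (2 * Real.log (n / δ) + (k + 1) * ℓ) := by positivity
    have : 0 ≤ lam * (m ^ 2 + 1) := by positivity
    have := sq_nonneg D
    rw [hK]; linarith
  calc ∑ t ∈ Finset.range T, instRegret γ g π ξ t ^ 2
      ≤ ∑ t ∈ Finset.range T, (4 * K * min 1 (sqWidth γ π ξ lam t) + 4 * D ^ 2 * b t) :=
        Finset.sum_le_sum fun t ht => hpt t (Finset.mem_range.1 ht)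
    _ = 4 * K * ∑ t ∈ Finset.range T, min 1 (sqWidth γ π ξ lam t)
        + ∑ t ∈ Finset.range T, 4 * D ^ 2 * b t := by
        rw [Finset.sum_add_distrib, Finset.mul_sum]
    _ ≤ _ := by
        gcongr
        refine (sum_min_one_sqWidth_le γ π ξ lam hlam T).trans ?_
        gcongr
        calc ∑ a, logDet γ π ξ lam T a ≤ ∑ _a : Fin n, (k + 1) * ℓ :=
              Finset.sum_le_sum fun a _ => hld T le_rfl a
          _ = _ := by simp

end
/-! ### Conditionally subgaussian variables with random parameters -/

section

variable {Ω : Type*} {𝓖 mΩ : MeasurableSpace Ω} {μ : Measure Ω} [IsProbabilityMeasure μ]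
  (h𝓖 : 𝓖 ≤ mΩ) {X : Ω → ℝ} {c : ℝ}

include h𝓖 in
-- The measure with density exp(sX - cs²/2) is dominated by μ on 𝓖, and F only sees 𝓖.
lemma lintegral_mul_exp_const_le (hint : ∀ s : ℝ, Integrable (fun ω => Real.exp (s * X ω)) μ)
    (hsub : ∀ s : ℝ, μ[fun ω => Real.exp (s * X ω) | 𝓖] ≤ᵐ[μ] fun _ => Real.exp (c * s ^ 2 / 2))
    {F : Ω → ENNReal} (hF : Measurable[𝓖] F) (s : ℝ) :
    ∫⁻ ω, F ω * ENNReal.ofReal (Real.exp (s * X ω - c * s ^ 2 / 2)) ∂μ ≤ ∫⁻ ω, F ω ∂μ := by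
  have hint' : Integrable (fun ω => Real.exp (s * X ω - c * s ^ 2 / 2)) μ := by
    simp only [Real.exp_sub]
    exact (hint s).div_const _
  have hae : AEMeasurable (fun ω => ENNReal.ofReal (Real.exp (s * X ω - c * s ^ 2 / 2))) μ :=
    hint'.aestronglyMeasurable.aemeasurable.ennreal_ofReal
  set ν := μ.withDensity fun ω => ENNReal.ofReal (Real.exp (s * X ω - c * s ^ 2 / 2)) with hν
  have hle : ν.trim h𝓖 ≤ μ.trim h𝓖 := by
    refine Measure.le_iff.2 fun A hA => ?_
    rw [trim_measurableSet_eq h𝓖 hA, trim_measurableSet_eq h𝓖 hA, hν,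
      withDensity_apply _ (h𝓖 A hA), ← ofReal_integral_eq_lintegral_ofReal hint'.integrableOn
        (Filter.Eventually.of_forall fun ω => (Real.exp_pos _).le)]
    have h1 : ∫ ω in A, Real.exp (s * X ω - c * s ^ 2 / 2) ∂μ ≤ μ.real A := by
      simp only [Real.exp_sub]
      rw [integral_div, div_le_iff₀ (Real.exp_pos _), ← setIntegral_condExp h𝓖 (hint s) hA]
      calc _ ≤ ∫ _ in A, Real.exp (c * s ^ 2 / 2) ∂μ :=
            setIntegral_mono_ae integrable_condExp.integrableOn (integrable_const _).integrableOn
              (hsub s)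
        _ = _ := by simp
    calc _ ≤ ENNReal.ofReal (μ.real A) := ENNReal.ofReal_le_ofReal h1
      _ = μ A := by simp
  calc ∫⁻ ω, F ω * ENNReal.ofReal (Real.exp (s * X ω - c * s ^ 2 / 2)) ∂μ
      = ∫⁻ ω, F ω ∂ν := by
        rw [hν, lintegral_withDensity_eq_lintegral_mul₀ hae (hF.mono h𝓖 le_rfl).aemeasurable]
        simp only [Pi.mul_apply, mul_comm]
    _ = ∫⁻ ω, F ω ∂(ν.trim h𝓖) := (lintegral_trim h𝓖 hF).symm
    _ ≤ ∫⁻ ω, F ω ∂(μ.trim h𝓖) := lintegral_mono' hle le_rfl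
    _ = _ := lintegral_trim h𝓖 hF

include h𝓖 in
lemma lintegral_mul_exp_simple_le (hX : Measurable X)
    (hint : ∀ s : ℝ, Integrable (fun ω => Real.exp (s * X ω)) μ)
    (hsub : ∀ s : ℝ, μ[fun ω => Real.exp (s * X ω) | 𝓖] ≤ᵐ[μ] fun _ => Real.exp (c * s ^ 2 / 2))
    {F : Ω → ENNReal} (hF : Measurable[𝓖] F) (s : @SimpleFunc Ω 𝓖 ℝ) :
    ∫⁻ ω, F ω * ENNReal.ofReal (Real.exp (s ω * X ω - c * s ω ^ 2 / 2)) ∂μ ≤ ∫⁻ ω, F ω ∂μ := by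
  classical
  have hind : ∀ y, Measurable[𝓖] ((s ⁻¹' {y}).indicator F) := fun y =>
    hF.indicator (@SimpleFunc.measurableSet_fiber _ _ 𝓖 s y)
  have hFsum : ∀ ω, ∑ y ∈ @SimpleFunc.range _ _ 𝓖 s, (s ⁻¹' {y}).indicator F ω = F ω := fun ω => by
    rw [Finset.sum_eq_single (s ω)]
    · simp
    · intro y _ hy
      exact Set.indicator_of_notMem (fun h => hy h.symm) _
    · intro h
      exact absurd (@SimpleFunc.mem_range_self _ _ 𝓖 s ω) h
  have hpt : ∀ ω, F ω * ENNReal.ofReal (Real.exp (s ω * X ω - c * s ω ^ 2 / 2))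
      = ∑ y ∈ @SimpleFunc.range _ _ 𝓖 s, (s ⁻¹' {y}).indicator F ω
        * ENNReal.ofReal (Real.exp (y * X ω - c * y ^ 2 / 2)) := fun ω => by
    rw [Finset.sum_eq_single (s ω)]
    · simp
    · intro y _ hy
      rw [Set.indicator_of_notMem (fun h => hy h.symm), zero_mul]
    · intro h
      exact absurd (@SimpleFunc.mem_range_self _ _ 𝓖 s ω) h
  simp only [hpt]
  have hm : ∀ y : ℝ, Measurable fun ω => ENNReal.ofReal (Real.exp (y * X ω - c * y ^ 2 / 2)) :=
    fun y => (Real.measurable_exp.comp ((hX.const_mul y).sub_const _)).ennreal_ofReal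
  rw [lintegral_finsetSum (@SimpleFunc.range _ _ 𝓖 s)
    (f := fun y ω => (s ⁻¹' {y}).indicator F ω
      * ENNReal.ofReal (Real.exp (y * X ω - c * y ^ 2 / 2)))
    fun y _ => ((hind y).mono h𝓖 le_rfl).mul (hm y)]
  calc _ ≤ ∑ y ∈ @SimpleFunc.range _ _ 𝓖 s, ∫⁻ ω, (s ⁻¹' {y}).indicator F ω ∂μ :=
        Finset.sum_le_sum fun y _ => lintegral_mul_exp_const_le h𝓖 hint hsub (hind y) y
    _ = _ := by
        rw [← lintegral_finsetSum _ fun y _ => (hind y).mono h𝓖 le_rfl]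
        simp only [hFsum]

include h𝓖 in
/-- The conditional subgaussian bound holds at random, conditionally known parameters. -/
lemma lintegral_mul_exp_le (hX : Measurable X)
    (hint : ∀ s : ℝ, Integrable (fun ω => Real.exp (s * X ω)) μ)
    (hsub : ∀ s : ℝ, μ[fun ω => Real.exp (s * X ω) | 𝓖] ≤ᵐ[μ] fun _ => Real.exp (c * s ^ 2 / 2))
    {F : Ω → ENNReal} (hF : Measurable[𝓖] F) {s : Ω → ℝ} (hs : Measurable[𝓖] s) :
    ∫⁻ ω, F ω * ENNReal.ofReal (Real.exp (s ω * X ω - c * s ω ^ 2 / 2)) ∂μ ≤ ∫⁻ ω, F ω ∂μ := by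
  have hs' : StronglyMeasurable[𝓖] s := hs.stronglyMeasurable
  let G : ℝ → Ω → ℝ := fun y ω => Real.exp (y * X ω - c * y ^ 2 / 2)
  have hlim : ∀ ω, Filter.Tendsto (fun i => F ω * ENNReal.ofReal (G (hs'.approx i ω) ω))
      Filter.atTop (nhds (F ω * ENNReal.ofReal (G (s ω) ω))) := fun ω => by
    refine ENNReal.Tendsto.const_mul (ENNReal.tendsto_ofReal ?_) (Or.inl ?_)
    · have hcont : Continuous fun y => G y ω := by
        show Continuous fun y => Real.exp (y * X ω - c * y ^ 2 / 2)
        fun_prop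
      exact (hcont.tendsto _).comp (hs'.tendsto_approx ω)
    · simpa using Real.exp_pos _
  -- Fatou's lemma passes from simple parameters to the limit; as only an upper bound is wanted, no
  -- domination is needed.
  calc ∫⁻ ω, F ω * ENNReal.ofReal (G (s ω) ω) ∂μ
      = ∫⁻ ω, Filter.liminf (fun i => F ω * ENNReal.ofReal (G (hs'.approx i ω) ω))
          Filter.atTop ∂μ := by
        simp only [fun ω => (hlim ω).liminf_eq]
    _ ≤ Filter.liminf (fun i => ∫⁻ ω, F ω * ENNReal.ofReal (G (hs'.approx i ω) ω) ∂μ)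
          Filter.atTop := by
        refine lintegral_liminf_le fun i => ?_
        have hsi : Measurable (hs'.approx i) :=
          (@SimpleFunc.measurable _ _ 𝓖 _ (hs'.approx i)).mono h𝓖 le_rfl
        exact (hF.mono h𝓖 le_rfl).mul
          (Real.measurable_exp.comp ((hsi.mul hX).sub
            (((hsi.pow_const 2).const_mul c).div_const 2))).ennreal_ofReal
    _ ≤ ∫⁻ ω, F ω ∂μ := by
        refine Filter.liminf_le_of_le (by isBoundedDefault) fun b hb => ?_
        obtain ⟨i, hi⟩ := hb.exists
        exact hi.trans (lintegral_mul_exp_simple_le h𝓖 hX hint hsub hF (hs'.approx i))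

/-- Completing the square turns the integrand times the standard Gaussian density into a constant
times the density of a Gaussian with variance 1/(1+v). -/
lemma lintegral_gaussian_exp_quadratic (x u : ℝ) {v : ℝ} (hv : 0 ≤ v) :
    ∫⁻ g, ENNReal.ofReal (Real.exp ((u + √v * g) * x - 1 * (u + √v * g) ^ 2 / 2)) ∂(gaussianReal 0 1)
      = ENNReal.ofReal (Real.exp ((2 * x * u + x ^ 2 * v - u ^ 2) / (2 * (1 + v))) / √(1 + v)) := by
  have h1 : 0 < 1 + v := by linarith
  let v' : NNReal := ⟨(1 + v)⁻¹, by positivity⟩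
  have hv' : v' ≠ 0 := by
    intro h
    have : (1 + v)⁻¹ = 0 := congrArg NNReal.toReal h
    exact (inv_pos.2 h1).ne' this
  set K : ℝ := Real.exp ((2 * x * u + x ^ 2 * v - u ^ 2) / (2 * (1 + v))) / √(1 + v) with hK
  have hpt : ∀ g, gaussianPDF 0 1 g
        * ENNReal.ofReal (Real.exp ((u + √v * g) * x - 1 * (u + √v * g) ^ 2 / 2))
      = ENNReal.ofReal K * gaussianPDF (√v * (x - u) / (1 + v)) v' g := by
    intro g
    rw [gaussianPDF, gaussianPDF, ← ENNReal.ofReal_mul (gaussianPDFReal_nonneg _ _ _),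
      ← ENNReal.ofReal_mul (by positivity)]
    congr 1
    rw [gaussianPDFReal, gaussianPDFReal, hK]
    have hvv : ((v' : NNReal) : ℝ) = (1 + v)⁻¹ := rfl
    have e1 : √(2 * Real.pi * (1 + v)⁻¹) = √(2 * Real.pi) / √(1 + v) := by
      rw [← div_eq_mul_inv, Real.sqrt_div' _ h1.le]
    have hs : √(1 + v) ≠ 0 := (Real.sqrt_pos.2 h1).ne'
    rw [hvv, e1, NNReal.coe_one, mul_one, inv_div]
    have e2 : ∀ A B C D s : ℝ, s ≠ 0 → A * B = C * D → (√(2 * Real.pi))⁻¹ * A * B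
        = C / s * (s / √(2 * Real.pi) * D) := by
      intro A B C D s hs h
      rw [mul_assoc, h]
      field_simp
    refine e2 _ _ _ _ _ hs ?_
    rw [← Real.exp_add, ← Real.exp_add]
    congr 1
    have hsq : √v ^ 2 = v := Real.sq_sqrt hv
    set r := √v
    rw [← hsq] at h1 ⊢
    field_simp
    ring
  rw [gaussianReal_of_var_ne_zero _ one_ne_zero,
    lintegral_withDensity_eq_lintegral_mul _ (measurable_gaussianPDF 0 1) (by fun_prop)]
  simp only [Pi.mul_apply, hpt]
  rw [lintegral_const_mul _ (measurable_gaussianPDF _ _), lintegral_gaussianPDF_eq_one _ hv', mul_one]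

include h𝓖 in
/-- One step of the method of mixtures. -/
lemma lintegral_mul_exp_mixture_le (hX : Measurable X)
    (hint : ∀ s : ℝ, Integrable (fun ω => Real.exp (s * X ω)) μ)
    (hsub : ∀ s : ℝ, μ[fun ω => Real.exp (s * X ω) | 𝓖] ≤ᵐ[μ] fun _ => Real.exp (1 * s ^ 2 / 2))
    {F : Ω → ENNReal} (hF : Measurable[𝓖] F) {u v : Ω → ℝ} (hu : Measurable[𝓖] u)
    (hv : Measurable[𝓖] v) (hv0 : ∀ ω, 0 ≤ v ω) :
    ∫⁻ ω, F ω * ENNReal.ofReal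
        (Real.exp ((2 * X ω * u ω + X ω ^ 2 * v ω - u ω ^ 2) / (2 * (1 + v ω))) / √(1 + v ω)) ∂μ
      ≤ ∫⁻ ω, F ω ∂μ := by
  have hF' := hF.mono h𝓖 le_rfl
  have hu' := hu.mono h𝓖 le_rfl
  have hv' := hv.mono h𝓖 le_rfl
  have hjoint : Measurable fun p : Ω × ℝ => F p.1 * ENNReal.ofReal
      (Real.exp ((u p.1 + √(v p.1) * p.2) * X p.1 - 1 * (u p.1 + √(v p.1) * p.2) ^ 2 / 2)) := by
    fun_prop
  -- The factor is the average of exp(sX - s²/2) over s = u + √v g with g standard Gaussian. After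
  -- Tonelli, s is 𝓖-measurable for each fixed g.
  calc _ = ∫⁻ ω, ∫⁻ g, F ω * ENNReal.ofReal
        (Real.exp ((u ω + √(v ω) * g) * X ω - 1 * (u ω + √(v ω) * g) ^ 2 / 2))
          ∂(gaussianReal 0 1) ∂μ := by
        refine lintegral_congr fun ω => ?_
        rw [lintegral_const_mul _ (by fun_prop), lintegral_gaussian_exp_quadratic _ _ (hv0 ω)]
    _ = ∫⁻ g, ∫⁻ ω, F ω * ENNReal.ofReal
        (Real.exp ((u ω + √(v ω) * g) * X ω - 1 * (u ω + √(v ω) * g) ^ 2 / 2)) ∂μ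
          ∂(gaussianReal 0 1) := lintegral_lintegral_swap hjoint.aemeasurable
    _ ≤ ∫⁻ _, ∫⁻ ω, F ω ∂μ ∂(gaussianReal 0 1) := by
        refine lintegral_mono fun g => ?_
        refine lintegral_mul_exp_le h𝓖 hX hint hsub hF (s := fun ω => u ω + √(v ω) * g) ?_
        exact hu.add (hv.sqrt.mul_const g)
    _ = _ := by simp

end

/-! ### Measurability of matrix functions -/

section

variable {α ι : Type*} [MeasurableSpace α] [Fintype ι] [DecidableEq ι]

lemma measurable_matrix_det {A : α → Matrix ι ι ℝ} (hA : ∀ i j, Measurable fun x => A x i j) :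
    Measurable fun x => (A x).det := by
  simp only [Matrix.det_apply]
  exact Finset.measurable_sum _ fun τ _ =>
    (Finset.measurable_prod _ fun i _ => hA _ _).const_smul _

lemma measurable_matrix_inv {A : α → Matrix ι ι ℝ} (hA : ∀ i j, Measurable fun x => A x i j)
    (i j : ι) : Measurable fun x => (A x)⁻¹ i j := by
  simp only [Matrix.inv_def, Ring.inverse_eq_inv', Matrix.smul_apply, smul_eq_mul,
    Matrix.adjugate_apply]
  refine (measurable_matrix_det hA).inv.mul (measurable_matrix_det fun p q => ?_)
  simp only [Matrix.updateRow_apply]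
  split_ifs
  · exact measurable_const
  · exact hA p q

lemma measurable_inv_quadratic {A : α → Matrix ι ι ℝ} (hA : ∀ i j, Measurable fun x => A x i j)
    {f g : α → ι → ℝ} (hf : Measurable f) (hg : Measurable g) :
    Measurable fun x => f x ⬝ᵥ (A x)⁻¹ *ᵥ g x := by
  refine measurable_dotProduct hf (measurable_pi_iff.2 fun i => ?_)
  exact measurable_dotProduct (measurable_pi_iff.2 fun j => measurable_matrix_inv hA i j) hg

end

/-! ### The concentration event -/

section

variable {Ω : Type*} {mΩ : MeasurableSpace Ω} {μ : Measure Ω} [IsProbabilityMeasure μ]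
  {ℱ : Filtration ℕ mΩ} {ξ : ℕ → Ω → ℝ} {σ : ℝ} {n k : ℕ} (γ : Fin n → Fin (k + 1) → ℝ)
  (π : Policy n) {lam : ℝ}

lemma measurable_selVec (hξ : ∀ t, Measurable[ℱ (t + 1)] (ξ (t + 1))) (t : ℕ) (a : Fin n) :
    Measurable[ℱ t] fun ω => selVec γ π (fun s => ξ s ω) t a := by
  have h := measurable_trajectory hξ γ π t
  let _ := ℱ t
  unfold selVec played
  refine Measurable.ite ?_ ((measurable_context k n t).comp h) measurable_const
  exact measurableSet_eq_fun measurable_const ((π.measurable_act t).comp h)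

lemma measurable_gramPath (hξ : ∀ t, Measurable[ℱ (t + 1)] (ξ (t + 1))) (t : ℕ) (a : Fin n)
    (i j : Fin (k + 1)) :
    Measurable[ℱ t] fun ω => gramPath γ π (fun s => ξ s ω) lam t a i j := by
  induction t with
  | zero => exact @measurable_const _ _ _ (ℱ 0) _
  | succ t ih =>
    have hsel := (measurable_selVec γ π hξ t a).mono (ℱ.mono (Nat.le_succ t)) le_rfl
    have ih' := ih.mono (ℱ.mono (Nat.le_succ t)) le_rfl
    let _ := ℱ (t + 1)
    simp only [gramPath_succ, Matrix.add_apply, Matrix.vecMulVec_apply]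
    exact ih'.add ((measurable_pi_iff.1 hsel i).mul (measurable_pi_iff.1 hsel j))

lemma measurable_noiseVec (hξ : ∀ t, Measurable[ℱ (t + 1)] (ξ (t + 1))) (t : ℕ) (a : Fin n) :
    Measurable[ℱ t] fun ω => noiseVec γ π (fun s => ξ s ω) t a := by
  induction t with
  | zero => exact @measurable_const _ _ _ (ℱ 0) _
  | succ t ih =>
    have hsel := (measurable_selVec γ π hξ t a).mono (ℱ.mono (Nat.le_succ t)) le_rfl
    have ih' := ih.mono (ℱ.mono (Nat.le_succ t)) le_rfl
    have hx := hξ t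
    let _ := ℱ (t + 1)
    simp only [noiseVec]
    exact ih'.add (hx.smul hsel)

lemma measurable_logDet (hξ : ∀ t, Measurable[ℱ (t + 1)] (ξ (t + 1))) (t : ℕ) (a : Fin n) :
    Measurable[ℱ t] fun ω => logDet γ π (fun s => ξ s ω) lam t a := by
  have h := fun i j => measurable_gramPath γ π (lam := lam) hξ t a i j
  let _ := ℱ t
  unfold logDet
  exact Real.measurable_log.comp ((measurable_matrix_det h).div_const _)

lemma measurable_noise_quadratic (hξ : ∀ t, Measurable[ℱ (t + 1)] (ξ (t + 1))) (t : ℕ)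
    (a : Fin n) :
    Measurable[ℱ t] fun ω => noiseVec γ π (fun s => ξ s ω) t a ⬝ᵥ
      (gramPath γ π (fun s => ξ s ω) lam t a)⁻¹ *ᵥ noiseVec γ π (fun s => ξ s ω) t a := by
  have h := fun i j => measurable_gramPath γ π (lam := lam) hξ t a i j
  have h2 := measurable_noiseVec γ π hξ t a
  let _ := ℱ t
  exact measurable_inv_quadratic h h2 h2

lemma measurableSet_concentrated (hξ : ∀ t, Measurable[ℱ (t + 1)] (ξ (t + 1))) (δ : ℝ) (t : ℕ) :
    MeasurableSet {ω | Concentrated γ π (fun s => ξ s ω) lam σ δ t} := by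
  simp only [Concentrated, Set.ofPred_forall]
  refine MeasurableSet.iInter fun a => measurableSet_le ?_ ?_
  · exact (measurable_noise_quadratic γ π hξ t a).mono (ℱ.le t) le_rfl
  · exact (((measurable_logDet γ π hξ t a).mono (ℱ.le t) le_rfl).const_add _).const_mul _

/-- The self-normalized exponential process of the noise in the regression of action `a`. -/
noncomputable def mixtureProcess {n k : ℕ} (γ : Fin n → Fin (k + 1) → ℝ) (π : Policy n)
    (lam σ : ℝ) (ξ : ℕ → ℝ) (t : ℕ) (a : Fin n) : ℝ :=
  Real.exp ((noiseVec γ π ξ t a ⬝ᵥ (gramPath γ π ξ lam t a)⁻¹ *ᵥ noiseVec γ π ξ t a / σ ^ 2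
    - logDet γ π ξ lam t a) / 2)

lemma measurable_mixtureProcess (hξ : ∀ t, Measurable[ℱ (t + 1)] (ξ (t + 1))) (t : ℕ)
    (a : Fin n) :
    Measurable[ℱ t] fun ω => mixtureProcess γ π lam σ (fun s => ξ s ω) t a := by
  have h1 := measurable_noise_quadratic γ π (lam := lam) hξ t a
  have h2 := measurable_logDet γ π (lam := lam) hξ t a
  let _ := ℱ t
  unfold mixtureProcess
  exact Real.measurable_exp.comp (((h1.div_const _).sub h2).div_const _)

/-- The rank-one updates of the quadratic form and of the determinant combine to exactly the
Gaussian mixture factor with x = ξ/σ, u = z·V⁻¹S/σ and v = z·V⁻¹z. -/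
lemma mixtureProcess_succ (hlam : 0 < lam) (hσ : 0 < σ) (ξ : ℕ → ℝ) (t : ℕ) (a : Fin n) :
    mixtureProcess γ π lam σ ξ (t + 1) a = mixtureProcess γ π lam σ ξ t a *
      (Real.exp ((2 * (ξ (t + 1) / σ)
          * (selVec γ π ξ t a ⬝ᵥ (gramPath γ π ξ lam t a)⁻¹ *ᵥ noiseVec γ π ξ t a / σ)
          + (ξ (t + 1) / σ) ^ 2
            * (selVec γ π ξ t a ⬝ᵥ (gramPath γ π ξ lam t a)⁻¹ *ᵥ selVec γ π ξ t a)
          - (selVec γ π ξ t a ⬝ᵥ (gramPath γ π ξ lam t a)⁻¹ *ᵥ noiseVec γ π ξ t a / σ) ^ 2)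
        / (2 * (1 + selVec γ π ξ t a ⬝ᵥ (gramPath γ π ξ lam t a)⁻¹ *ᵥ selVec γ π ξ t a)))
        / √(1 + selVec γ π ξ t a ⬝ᵥ (gramPath γ π ξ lam t a)⁻¹ *ᵥ selVec γ π ξ t a)) := by
  have hV := gramPath_posDef γ π ξ lam hlam t a
  have hv := inv_quadratic_nonneg hV (selVec γ π ξ t a)
  rw [mixtureProcess, mixtureProcess, noiseVec, gramPath_succ, inv_quadratic_update hV,
    logDet_succ γ π ξ lam hlam]
  set v := selVec γ π ξ t a ⬝ᵥ (gramPath γ π ξ lam t a)⁻¹ *ᵥ selVec γ π ξ t a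
  set u := selVec γ π ξ t a ⬝ᵥ (gramPath γ π ξ lam t a)⁻¹ *ᵥ noiseVec γ π ξ t a
  have h1 : 0 < 1 + v := by linarith
  have hsq : √(1 + v) = Real.exp (Real.log (1 + v) / 2) := by
    rw [← Real.log_sqrt h1.le, Real.exp_log (Real.sqrt_pos.2 h1)]
  rw [hsq, ← Real.exp_sub, ← Real.exp_add]
  congr 1
  field_simp
  ring

variable {γ π}

lemma lintegral_mixtureProcess_le_one (hlam : 0 < lam) (hσ : 0 < σ)
    (hξ : IsSubgaussianNoise μ ℱ ξ σ) (t : ℕ) (a : Fin n) :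
    ∫⁻ ω, ENNReal.ofReal (mixtureProcess γ π lam σ (fun s => ξ s ω) t a) ∂μ ≤ 1 := by
  induction t with
  | zero => simp [mixtureProcess, noiseVec, logDet_zero _ _ _ _ hlam]
  | succ t ih =>
    refine le_trans ?_ ih
    have hX : Measurable fun ω => ξ (t + 1) ω / σ :=
      ((hξ.measurable t).mono (ℱ.le _) le_rfl).div_const σ
    have hint : ∀ s : ℝ, Integrable (fun ω => Real.exp (s * (ξ (t + 1) ω / σ))) μ := fun s => by
      have := hξ.integrable_exp t (s / σ)
      refine this.congr (Filter.Eventually.of_forall fun ω => ?_)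
      show Real.exp (s / σ * ξ (t + 1) ω) = Real.exp (s * (ξ (t + 1) ω / σ))
      congr 1; ring
    have hsub : ∀ s : ℝ, μ[fun ω => Real.exp (s * (ξ (t + 1) ω / σ)) | ℱ t]
        ≤ᵐ[μ] fun _ => Real.exp (1 * s ^ 2 / 2) := fun s => by
      have h := hξ.condExp_exp_le t (s / σ)
      have e1 : (fun ω => Real.exp (s / σ * ξ (t + 1) ω))
          = fun ω => Real.exp (s * (ξ (t + 1) ω / σ)) := by
        funext ω; congr 1; ring
      have e2 : σ ^ 2 * (s / σ) ^ 2 / 2 = 1 * s ^ 2 / 2 := by field_simp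
      rwa [e1, e2] at h
    have hsel := measurable_selVec γ π hξ.measurable t a
    have hno := measurable_noiseVec γ π hξ.measurable t a
    have hV := fun i j => measurable_gramPath γ π (lam := lam) hξ.measurable t a i j
    have hmix := measurable_mixtureProcess γ π (lam := lam) (σ := σ) hξ.measurable t a
    have key := lintegral_mul_exp_mixture_le (μ := μ) (ℱ.le t) hX hint hsub
      (F := fun ω => ENNReal.ofReal (mixtureProcess γ π lam σ (fun s => ξ s ω) t a))
      (u := fun ω => selVec γ π (fun s => ξ s ω) t a ⬝ᵥ
        (gramPath γ π (fun s => ξ s ω) lam t a)⁻¹ *ᵥ noiseVec γ π (fun s => ξ s ω) t a / σ)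
      (v := fun ω => selVec γ π (fun s => ξ s ω) t a ⬝ᵥ
        (gramPath γ π (fun s => ξ s ω) lam t a)⁻¹ *ᵥ selVec γ π (fun s => ξ s ω) t a)
      (by let _ := ℱ t; exact hmix.ennreal_ofReal)
      (by let _ := ℱ t; exact (measurable_inv_quadratic hV hsel hno).div_const σ)
      (by let _ := ℱ t; exact measurable_inv_quadratic hV hsel hsel)
      (fun ω => inv_quadratic_nonneg (gramPath_posDef γ π _ lam hlam t a) _)
    refine le_trans (le_of_eq (lintegral_congr fun ω => ?_)) key
    rw [mixtureProcess_succ γ π hlam hσ, ENNReal.ofReal_mul]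
    exact (Real.exp_pos _).le

lemma integral_exp_le (hξ : IsSubgaussianNoise μ ℱ ξ σ) (t : ℕ) (s : ℝ) :
    ∫ ω, Real.exp (s * ξ (t + 1) ω) ∂μ ≤ Real.exp (σ ^ 2 * s ^ 2 / 2) := by
  rw [← integral_condExp (ℱ.le t)]
  calc _ ≤ ∫ _, Real.exp (σ ^ 2 * s ^ 2 / 2) ∂μ :=
        integral_mono_ae integrable_condExp (integrable_const _) (hξ.condExp_exp_le t s)
    _ = _ := by simp

/-- The nonnegative variable e^ξ + e^{-ξ} - 2 has mean at most 0. This covers σ = 0, where the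
mixture process would divide by zero. -/
lemma noise_ae_eq_zero (hξ : IsSubgaussianNoise μ ℱ ξ 0) (t : ℕ) : ξ (t + 1) =ᵐ[μ] 0 := by
  have h1 := hξ.integrable_exp t 1
  have h2 := hξ.integrable_exp t (-1)
  have e1 := integral_exp_le hξ t 1
  have e2 := integral_exp_le hξ t (-1)
  have hnn : ∀ y : ℝ, 0 ≤ Real.exp (1 * y) + Real.exp (-1 * y) - 2 := fun y => by
    have := Real.one_le_cosh y
    rw [Real.cosh_eq] at this
    simp only [one_mul, neg_mul]
    linarith
  have hi : Integrable
      (fun ω => Real.exp (1 * ξ (t + 1) ω) + Real.exp (-1 * ξ (t + 1) ω) - 2) μ :=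
    (h1.add h2).sub (integrable_const 2)
  have h0 : ∫ ω, (Real.exp (1 * ξ (t + 1) ω) + Real.exp (-1 * ξ (t + 1) ω) - 2) ∂μ = 0 := by
    refine le_antisymm ?_ (integral_nonneg fun ω => hnn _)
    rw [integral_sub (f := fun ω => Real.exp (1 * ξ (t + 1) ω) + Real.exp (-1 * ξ (t + 1) ω))
      (h1.add h2) (integrable_const 2), integral_add h1 h2]
    simp only [integral_const, probReal_univ, smul_eq_mul]
    norm_num at e1 e2 ⊢
    linarith
  rw [integral_eq_zero_iff_of_nonneg (fun ω => hnn _) hi] at h0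
  filter_upwards [h0] with ω hω
  simp only [Pi.zero_apply, one_mul, neg_mul] at hω ⊢
  have : Real.cosh (ξ (t + 1) ω) = 1 := by rw [Real.cosh_eq]; linarith
  by_contra hne
  exact ((Real.one_lt_cosh.2 hne).ne') this

/-- Markov's inequality at level n/δ for each mixture process, then a union bound over the actions.
A fixed round suffices, since later only the expected number of failures matters. -/
lemma measure_not_concentrated_le (hlam : 0 < lam) (hσ : 0 ≤ σ) (hn : 1 ≤ n)
    (hξ : IsSubgaussianNoise μ ℱ ξ σ) {δ : ℝ} (hδ : 0 < δ) (t : ℕ) :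
    μ.real {ω | ¬ Concentrated γ π (fun s => ξ s ω) lam σ δ t} ≤ δ := by
  rcases hσ.eq_or_lt with rfl | hσ
  · have h0 : ∀ᵐ ω ∂μ, ∀ s, ξ (s + 1) ω = 0 := by
      rw [ae_all_iff]
      exact fun s => noise_ae_eq_zero hξ s
    have : ∀ᵐ ω ∂μ, Concentrated γ π (fun s => ξ s ω) lam 0 δ t := by
      filter_upwards [h0] with ω hω
      intro a
      have hz : ∀ s, noiseVec γ π (fun s => ξ s ω) s a = 0 := by
        intro s
        induction s with
        | zero => rfl
        | succ s ih => simp [noiseVec, ih, hω s]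
      simp [hz]
    rw [Measure.real, show μ {ω | ¬ Concentrated γ π (fun s => ξ s ω) lam 0 δ t} = 0 from this]
    simpa using hδ.le
  · have hnpos : (0 : ℝ) < n := by exact_mod_cast hn
    have hnδ : 0 < n / δ := by positivity
    have hsub : {ω | ¬ Concentrated γ π (fun s => ξ s ω) lam σ δ t}
        ⊆ ⋃ a : Fin n, {ω | ENNReal.ofReal (n / δ)
          ≤ ENNReal.ofReal (mixtureProcess γ π lam σ (fun s => ξ s ω) t a)} := by
      intro ω hω
      simp only [Concentrated, Set.mem_ofPred_eq, not_forall, not_le] at hω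
      obtain ⟨a, ha⟩ := hω
      refine Set.mem_iUnion.2 ⟨a, ENNReal.ofReal_le_ofReal ?_⟩
      rw [mixtureProcess, ← Real.log_le_iff_le_exp hnδ]
      rw [← lt_div_iff₀' (by positivity)] at ha
      linarith
    have hone : ∀ a, μ {ω | ENNReal.ofReal (n / δ)
        ≤ ENNReal.ofReal (mixtureProcess γ π lam σ (fun s => ξ s ω) t a)}
        ≤ ENNReal.ofReal (δ / n) := by
      intro a
      have hm : Measurable fun ω =>
          ENNReal.ofReal (mixtureProcess γ π lam σ (fun s => ξ s ω) t a) :=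
        ((measurable_mixtureProcess γ π hξ.measurable t a).mono (ℱ.le t) le_rfl).ennreal_ofReal
      have h := meas_ge_le_lintegral_div (μ := μ) hm.aemeasurable
        (ε := ENNReal.ofReal (n / δ)) (by simpa using hnδ) ENNReal.ofReal_ne_top
      refine h.trans ?_
      calc _ ≤ 1 / ENNReal.ofReal (n / δ) := by
            gcongr
            exact lintegral_mixtureProcess_le_one hlam hσ hξ t a
        _ = _ := by
            rw [one_div, ← ENNReal.ofReal_inv_of_pos hnδ, inv_div]
    have : μ {ω | ¬ Concentrated γ π (fun s => ξ s ω) lam σ δ t} ≤ ENNReal.ofReal δ := by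
      calc _ ≤ ∑ a : Fin n, ENNReal.ofReal (δ / n) :=
            (measure_mono hsub).trans ((measure_iUnion_fintype_le μ _).trans
              (Finset.sum_le_sum fun a _ => hone a))
        _ = ENNReal.ofReal δ := by
            rw [Finset.sum_const, Finset.card_univ, Fintype.card_fin, nsmul_eq_mul,
              ← ENNReal.ofReal_natCast, ← ENNReal.ofReal_mul hnpos.le]
            congr 1
            field_simp
    exact ENNReal.toReal_le_of_le_ofReal hδ.le this

lemma integrable_exp_abs (hξ : IsSubgaussianNoise μ ℱ ξ σ) (t : ℕ) (s : ℝ) :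
    Integrable (fun ω => Real.exp (s * |ξ (t + 1) ω|)) μ ∧
      ∫ ω, Real.exp (s * |ξ (t + 1) ω|) ∂μ ≤ 2 * Real.exp (σ ^ 2 * s ^ 2 / 2) := by
  have h1 := hξ.integrable_exp t s
  have h2 := hξ.integrable_exp t (-s)
  have hle : ∀ y : ℝ, Real.exp (s * |y|) ≤ Real.exp (s * y) + Real.exp (-s * y) := fun y => by
    rcases abs_choice y with h | h <;> rw [h]
    · linarith [Real.exp_pos (-s * y)]
    · rw [mul_neg, neg_mul]; linarith [Real.exp_pos (s * y)]
  have hm : Measurable fun ω => Real.exp (s * |ξ (t + 1) ω|) :=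
    Real.measurable_exp.comp
      ((continuous_abs.measurable.comp ((hξ.measurable t).mono (ℱ.le _) le_rfl)).const_mul s)
  have hi : Integrable (fun ω => Real.exp (s * |ξ (t + 1) ω|)) μ := by
    refine (h1.add h2).mono' hm.aestronglyMeasurable (Filter.Eventually.of_forall fun ω => ?_)
    rw [Real.norm_of_nonneg (Real.exp_pos _).le]
    exact hle _
  refine ⟨hi, ?_⟩
  have e1 := integral_exp_le hξ t s
  have e2 := integral_exp_le hξ t (-s)
  rw [neg_sq] at e2
  calc _ ≤ ∫ ω, (Real.exp (s * ξ (t + 1) ω) + Real.exp (-s * ξ (t + 1) ω)) ∂μ :=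
        integral_mono hi (h1.add h2) fun ω => hle _
    _ ≤ _ := by rw [integral_add h1 h2]; linarith

end
/-! ### The regret bound -/

/-- Beyond τ one has y^p ≤ p! e^y ≤ p! e^{2y-τ}. This trades a power of the noise for a power of a
logarithm plus a small exponential moment. -/
lemma pow_le_pow_add_factorial_mul_exp {y τ : ℝ} (hy : 0 ≤ y) (hτ : 0 ≤ τ) (p : ℕ) :
    y ^ p ≤ τ ^ p + p.factorial * Real.exp (2 * y - τ) := by
  have hf : (0 : ℝ) < p.factorial := by exact_mod_cast p.factorial_pos
  rcases le_total y τ with h | h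
  · have := pow_le_pow_left₀ hy h p
    have : 0 ≤ p.factorial * Real.exp (2 * y - τ) := by positivity
    linarith
  · have h1 := Real.pow_div_factorial_le_exp y hy p
    rw [div_le_iff₀ hf] at h1
    have h2 : Real.exp y ≤ Real.exp (2 * y - τ) := Real.exp_le_exp.2 (by linarith)
    have h3 : Real.exp y * p.factorial ≤ p.factorial * Real.exp (2 * y - τ) := by
      rw [mul_comm]; gcongr
    have : 0 ≤ τ ^ p := by positivity
    linarith

/-- The argument of the logarithm in the regret bound dominates each of its factors. -/
lemma log_factors_le {n k T : ℕ} {m σ Γ : ℝ} (hn : 1 ≤ n) (hT : 1 ≤ T) (hm0 : 0 ≤ m)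
    (hσ : 0 ≤ σ) (hΓ0 : 0 ≤ Γ) (hΓ1 : Γ < 1) :
    0 ≤ Real.log n ∧ 0 ≤ Real.log T ∧ 0 ≤ Real.log (k + 1) ∧
      0 ≤ Real.log ((1 + m + σ) / (1 - Γ)) ∧
      Real.log (n * T * (k + 1) * (1 + m + σ) / (1 - Γ))
        = Real.log n + Real.log T + Real.log (k + 1) + Real.log ((1 + m + σ) / (1 - Γ)) := by
  have h1 : (1 : ℝ) ≤ n := by exact_mod_cast hn
  have h2 : (1 : ℝ) ≤ T := by exact_mod_cast hT
  have h3 : (1 : ℝ) ≤ k + 1 := by linarith [(Nat.cast_nonneg k : (0 : ℝ) ≤ k)]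
  have h4 : 0 < 1 - Γ := by linarith
  have h5 : 1 ≤ (1 + m + σ) / (1 - Γ) := by rw [le_div_iff₀ h4]; linarith
  refine ⟨Real.log_nonneg h1, Real.log_nonneg h2, Real.log_nonneg h3, Real.log_nonneg h5, ?_⟩
  rw [mul_div_assoc, Real.log_mul (by positivity) (by positivity),
    Real.log_mul (by positivity) (by positivity), Real.log_mul (by positivity) (by positivity)]

/-- From 1 + D ≤ (1+m+σ)(1+s)/(1-Γ) and log(1+s) ≤ s, the noise level s enters the log determinant
bound only linearly. -/
lemma log_det_bound_le {k T : ℕ} {m σ Γ lam s D : ℝ} (hT : 1 ≤ T) (hm0 : 0 ≤ m) (hσ : 0 ≤ σ)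
    (hΓ1 : Γ < 1) (hΓ0 : 0 ≤ Γ) (hlam : 0 < lam) (hs : 0 ≤ s)
    (hD : D = (m + (m + σ) * s) / (1 - Γ)) :
    Real.log ((k + 1) * (1 + T * (1 + D ^ 2) / lam))
      ≤ Real.log (k + 1) + Real.log T + 1 / lam + 2 * (Real.log ((1 + m + σ) / (1 - Γ)) + s) := by
  have h2 : (1 : ℝ) ≤ T := by exact_mod_cast hT
  have h4 : 0 < 1 - Γ := by linarith
  have hD0 : 0 ≤ D := by rw [hD]; positivity
  set q := (1 + m + σ) / (1 - Γ) with hq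
  have hq0 : 0 < q := by positivity
  have hDle : 1 + D ≤ q * (1 + s) := by
    rw [hD, hq, div_mul_eq_mul_div, le_div_iff₀ h4, add_mul, div_mul_cancel₀ _ h4.ne']
    nlinarith [mul_nonneg hΓ0 hs]
  have h5 : (1 : ℝ) + D ^ 2 ≤ (q * (1 + s)) ^ 2 :=
    (by nlinarith : 1 + D ^ 2 ≤ (1 + D) ^ 2).trans (pow_le_pow_left₀ (by linarith) hDle 2)
  have h6 : (1 : ℝ) + T * (1 + D ^ 2) / lam ≤ T * ((1 + 1 / lam) * (q * (1 + s)) ^ 2) := by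
    have h7 : (1 : ℝ) ≤ 1 + D ^ 2 := by nlinarith
    have h8 : (1 : ℝ) ≤ T * (1 + D ^ 2) := by nlinarith
    calc (1 : ℝ) + T * (1 + D ^ 2) / lam ≤ T * (1 + D ^ 2) + T * (1 + D ^ 2) / lam := by linarith
      _ = T * ((1 + 1 / lam) * (1 + D ^ 2)) := by field_simp
      _ ≤ _ := by gcongr
  have hl1 : Real.log (1 + 1 / lam) ≤ 1 / lam := by
    have := Real.log_le_sub_one_of_pos (show 0 < 1 + 1 / lam by positivity)
    linarith
  have hl2 : Real.log (1 + s) ≤ s := by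
    have := Real.log_le_sub_one_of_pos (show 0 < 1 + s by positivity)
    linarith
  calc _ ≤ Real.log ((k + 1) * (T * ((1 + 1 / lam) * (q * (1 + s)) ^ 2))) :=
        Real.log_le_log (by positivity) (by gcongr)
    _ = Real.log (k + 1) + (Real.log T + (Real.log (1 + 1 / lam)
          + 2 * (Real.log q + Real.log (1 + s)))) := by
        rw [Real.log_mul (by positivity) (by positivity), Real.log_mul (by positivity) (by positivity),
          Real.log_mul (by positivity) (by positivity), Real.log_pow,
          Real.log_mul (by positivity) (by positivity)]
        push_cast; rfl
    _ ≤ _ := by linarith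

/-- The constant of the pathwise bound. -/
noncomputable def pathConst (lam : ℝ) : ℝ :=
  8 * (2 + 1 / lam) * (1 + 2 * lam + 4 + 2 * (2 + 1 / lam))

lemma pathConst_pos {lam : ℝ} (hlam : 0 < lam) : 0 < pathConst lam := by
  unfold pathConst; positivity

section

variable {n k T : ℕ} {m σ Γ lam : ℝ} {γ : Fin n → Fin (k + 1) → ℝ} {g π : Policy n} {ξ : ℕ → ℝ}

/-- The pathwise bound in terms of the largest normalized noise `s`. -/
lemma sum_sq_instRegret_le_poly (hn : 1 ≤ n) (hT : 1 ≤ T) (hσ : 0 ≤ σ) (hlam : 0 < lam)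
    (hγ : ∀ a i, 0 ≤ γ a i) (hΓ0 : 0 ≤ Γ) (hΓ1 : Γ < 1) (hΓ : ∀ a, ∑ i : Fin k, γ a i.succ ≤ Γ)
    (hm : ∀ a, γ a 0 ≤ m) (hm0 : 0 ≤ m) (hg : IsGreedy γ g)
    (hπ : IsARUCB k lam m σ (1 / (2 * (T : ℝ))) T π) {L s : ℝ}
    (hL : L = 1 + Real.log (n * T * (k + 1) * (1 + m + σ) / (1 - Γ)))
    (hs0 : 0 ≤ s) (hs : ∀ t < T, |ξ (t + 1)| ≤ (m + σ) * s)
    {b : ℕ → ℝ} (hb0 : ∀ t, 0 ≤ b t)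
    (hb : ∀ t, ¬ Concentrated γ π ξ lam σ (1 / (2 * (T : ℝ))) t → 1 ≤ b t) :
    ∑ t ∈ Finset.range T, instRegret γ g π ξ t ^ 2
      ≤ (m + σ + 1) ^ 2 / (1 - Γ) ^ 2 * (n * (k + 1) ^ 2)
        * (pathConst lam * (L + s) ^ 3 + 4 * (1 + s) ^ 2 * ∑ t ∈ Finset.range T, b t) := by
  obtain ⟨l1, l2, l3, l4, l5⟩ := log_factors_le (k := k) hn hT hm0 hσ hΓ0 hΓ1
  rw [l5] at hL
  have hn' : (1 : ℝ) ≤ n := by exact_mod_cast hn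
  have hT' : (1 : ℝ) ≤ T := by exact_mod_cast hT
  have hd : (1 : ℝ) ≤ k + 1 := by linarith [(Nat.cast_nonneg k : (0 : ℝ) ≤ k)]
  have hg0 : 0 < 1 - Γ := by linarith
  have hL1 : 1 ≤ L := by linarith
  set D := (m + (m + σ) * s) / (1 - Γ) with hD
  set ℓ := Real.log ((k + 1) * (1 + T * (1 + D ^ 2) / lam)) with hℓ
  set q := L + s with hq
  have hq1 : 1 ≤ q := by linarith
  set c := 2 + 1 / lam with hc
  have hc0 : 0 < c := by positivity
  have hℓq : ℓ ≤ c * q := by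
    have h := log_det_bound_le (k := k) hT hm0 hσ hΓ1 hΓ0 hlam hs0 hD
    have : 1 / lam ≤ 1 / lam * q := le_mul_of_one_le_right (by positivity) hq1
    rw [hc, add_mul]
    linarith
  have hnδ : Real.log (n / (1 / (2 * (T : ℝ)))) = Real.log 2 + Real.log n + Real.log T := by
    rw [div_div_eq_mul_div, div_one, Real.log_mul (by positivity) (by positivity),
      Real.log_mul (by positivity) (by positivity)]
    ring
  have hlog2 : Real.log 2 ≤ 1 := by linarith [Real.log_two_lt_d9]
  have hnδ1 : Real.log (n / (1 / (2 * (T : ℝ)))) ≤ q := by rw [hnδ]; linarith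
  have hnδ0 : 0 ≤ Real.log (n / (1 / (2 * (T : ℝ)))) := by
    rw [hnδ]
    have := Real.log_nonneg (show (1 : ℝ) ≤ 2 by norm_num)
    linarith
  have hℓ0 : 0 ≤ ℓ := by
    have h1 : (0 : ℝ) ≤ T * (1 + D ^ 2) / lam := by positivity
    exact Real.log_nonneg (one_le_mul_of_one_le_of_one_le hd (by linarith))
  have key := sum_sq_instRegret_le (g := g) ξ hlam hσ hγ hΓ1 hΓ hm hm0
    (mul_nonneg (by linarith) hs0) hs hD hℓ hnδ0 hg hπ hb0 hb
  refine key.trans ?_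
  set R := (m + σ + 1) ^ 2 / (1 - Γ) ^ 2 with hR
  have hgle : (1 - Γ) ^ 2 ≤ 1 := pow_le_one₀ hg0.le (by linarith)
  have hRge : (m + σ + 1) ^ 2 ≤ R := by
    rw [hR, le_div_iff₀ (by positivity)]
    exact mul_le_of_le_one_right (sq_nonneg _) hgle
  have hR1 : 1 ≤ R := (one_le_pow₀ (by linarith)).trans hRge
  have hDs : D ≤ (m + σ + 1) * (1 + s) / (1 - Γ) := by
    rw [hD]
    gcongr
    linarith [show (m + σ + 1) * (1 + s) = m + (m + σ) * s + (σ + 1 + s) by ring]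
  have hD0 : 0 ≤ D := by rw [hD]; positivity
  have hD2 : D ^ 2 ≤ R * (1 + s) ^ 2 := by
    calc D ^ 2 ≤ ((m + σ + 1) * (1 + s) / (1 - Γ)) ^ 2 := pow_le_pow_left₀ hD0 hDs 2
      _ = _ := by rw [hR, div_pow, mul_pow, mul_div_right_comm]
  have hqsq : q ≤ q ^ 2 := le_self_pow₀ hq1 two_ne_zero
  have hdq : q ^ 2 ≤ (k + 1) * q ^ 2 := le_mul_of_one_le_left (by positivity) hd
  have hK : D ^ 2 + (2 * (lam * (m ^ 2 + 1))
          + 2 * (σ ^ 2 * (2 * Real.log (n / (1 / (2 * (T : ℝ)))) + (k + 1) * ℓ)))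
      ≤ R * ((k + 1) * q ^ 2) * (1 + 2 * lam + 4 + 2 * c) := by
    have hdq0 : 1 ≤ (k + 1) * q ^ 2 := one_le_mul_of_one_le_of_one_le hd (one_le_pow₀ hq1)
    have e1 : D ^ 2 ≤ R * ((k + 1) * q ^ 2) := by
      refine hD2.trans (mul_le_mul_of_nonneg_left ?_ (by linarith))
      exact (pow_le_pow_left₀ (by linarith) (by linarith : 1 + s ≤ q) 2).trans hdq
    have e2 : m ^ 2 + 1 ≤ R * ((k + 1) * q ^ 2) := by
      have : m ^ 2 + 1 ≤ (m + σ + 1) ^ 2 := by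
        linarith only [hm0, hσ, mul_nonneg hm0 hσ, sq_nonneg σ,
          show (m + σ + 1) ^ 2 = m ^ 2 + 1 + σ ^ 2 + 2 * (m * σ) + 2 * m + 2 * σ by ring]
      exact (this.trans hRge).trans (le_mul_of_one_le_right (by linarith) hdq0)
    have e3 : σ ^ 2 ≤ R := (pow_le_pow_left₀ hσ (by linarith) 2).trans hRge
    have e4 : 2 * Real.log (n / (1 / (2 * (T : ℝ)))) + (k + 1) * ℓ
        ≤ ((k + 1) * q ^ 2) * (2 + c) := by
      have : (k + 1) * ℓ ≤ (k + 1) * q ^ 2 * c := by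
        calc ((k : ℝ) + 1) * ℓ ≤ (k + 1) * (c * q ^ 2) := by
              gcongr
              exact hℓq.trans (by gcongr)
          _ = _ := by ring
      linarith
    have e5 : σ ^ 2 * (2 * Real.log (n / (1 / (2 * (T : ℝ)))) + (k + 1) * ℓ)
        ≤ R * (((k + 1) * q ^ 2) * (2 + c)) := by gcongr
    have e6 : lam * (m ^ 2 + 1) ≤ lam * (R * ((k + 1) * q ^ 2)) := by gcongr
    linarith
  have hmain : 4 * (D ^ 2 + (2 * (lam * (m ^ 2 + 1))
          + 2 * (σ ^ 2 * (2 * Real.log (n / (1 / (2 * (T : ℝ)))) + (k + 1) * ℓ))))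
            * (2 * (n * ((k + 1) * ℓ)))
      ≤ R * (n * (k + 1) ^ 2) * (pathConst lam * q ^ 3) := by
    calc _ ≤ 4 * (R * ((k + 1) * q ^ 2) * (1 + 2 * lam + 4 + 2 * c))
            * (2 * (n * ((k + 1) * (c * q)))) := by gcongr
      _ = _ := by rw [pathConst, ← hc]; ring
  have hbad : ∑ t ∈ Finset.range T, 4 * D ^ 2 * b t
      ≤ R * (n * (k + 1) ^ 2) * (4 * (1 + s) ^ 2 * ∑ t ∈ Finset.range T, b t) := by
    rw [← Finset.mul_sum]
    have hB : 0 ≤ ∑ t ∈ Finset.range T, b t := Finset.sum_nonneg fun t _ => hb0 t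
    have h1 : (1 : ℝ) ≤ n * (k + 1) ^ 2 :=
      one_le_mul_of_one_le_of_one_le hn' (one_le_pow₀ hd)
    calc _ ≤ 4 * (R * (1 + s) ^ 2) * ∑ t ∈ Finset.range T, b t := by gcongr
      _ = R * 1 * (4 * (1 + s) ^ 2 * ∑ t ∈ Finset.range T, b t) := by ring
      _ ≤ _ := by gcongr
  exact (add_le_add hmain hbad).trans_eq (mul_add _ _ _).symm

/-- The pathwise bound with the noise entering linearly, through exponential moments. -/
lemma sum_sq_instRegret_le_exp (hn : 1 ≤ n) (hT : 1 ≤ T) (hσ : 0 ≤ σ) (hlam : 0 < lam)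
    (hγ : ∀ a i, 0 ≤ γ a i) (hΓ0 : 0 ≤ Γ) (hΓ1 : Γ < 1) (hΓ : ∀ a, ∑ i : Fin k, γ a i.succ ≤ Γ)
    (hm : ∀ a, γ a 0 ≤ m) (hm0 : 0 ≤ m) (hρ : 0 < m + σ) (hg : IsGreedy γ g)
    (hπ : IsARUCB k lam m σ (1 / (2 * (T : ℝ))) T π) {L : ℝ}
    (hL : L = 1 + Real.log (n * T * (k + 1) * (1 + m + σ) / (1 - Γ)))
    {b : ℕ → ℝ} (hb0 : ∀ t, 0 ≤ b t) (hb1 : ∀ t, b t ≤ 1)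
    (hb : ∀ t, ¬ Concentrated γ π ξ lam σ (1 / (2 * (T : ℝ))) t → 1 ≤ b t) {E : ℝ}
    (hE : E = ∑ t ∈ Finset.range T, Real.exp (2 / (m + σ) * |ξ (t + 1)|) / T ^ 2) :
    ∑ t ∈ Finset.range T, instRegret γ g π ξ t ^ 2
      ≤ (m + σ + 1) ^ 2 / (1 - Γ) ^ 2 * (n * (k + 1) ^ 2)
        * (pathConst lam * (36 * L ^ 3 + 24 * E)
          + (40 * L ^ 2 * ∑ t ∈ Finset.range T, b t + 16 * T * E)) := by
  obtain ⟨l1, l2, l3, l4, l5⟩ := log_factors_le (k := k) hn hT hm0 hσ hΓ0 hΓ1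
  have hT' : (1 : ℝ) ≤ T := by exact_mod_cast hT
  have hg0 : 0 < 1 - Γ := by linarith
  obtain ⟨t₀, ht₀, hmax⟩ := Finset.exists_max_image (Finset.range T) (fun t => |ξ (t + 1)|)
    ⟨0, Finset.mem_range.2 hT⟩
  -- Normalizing by m + σ rather than σ allows σ = 0.
  set s := |ξ (t₀ + 1)| / (m + σ) with hs
  have hs0 : 0 ≤ s := by positivity
  have hsS : (m + σ) * s = |ξ (t₀ + 1)| := by rw [hs]; field_simp
  have h := sum_sq_instRegret_le_poly (g := g) hn hT hσ hlam hγ hΓ0 hΓ1 hΓ hm hm0 hg hπ hL hs0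
    (fun t ht => by rw [hsS]; exact hmax t (Finset.mem_range.2 ht)) hb0 hb
  refine h.trans ?_
  rw [l5] at hL
  have hL1 : 1 ≤ L := by linarith
  -- Then e^{-τ} = T⁻², so the T exponentials summed in `E` have total mean O(1/T), which survives
  -- the factor T below.
  set τ := 2 * Real.log T with hτ
  have hτ0 : 0 ≤ τ := by positivity
  have hτL : τ ≤ 2 * L := by linarith
  have hexp : Real.exp (2 * s - τ) ≤ E := by
    have e1 : Real.exp (2 * s - τ) = Real.exp (2 / (m + σ) * |ξ (t₀ + 1)|) / T ^ 2 := by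
      have e2 : Real.exp τ = (T : ℝ) ^ 2 := by
        rw [hτ, show (2 : ℝ) * Real.log T = ((2 : ℕ) : ℝ) * Real.log T by norm_num, Real.exp_nat_mul,
          Real.exp_log (by positivity)]
      rw [Real.exp_sub, e2, hs]
      congr 2
      ring
    rw [e1, hE]
    exact Finset.single_le_sum (f := fun t => Real.exp (2 / (m + σ) * |ξ (t + 1)|) / (T : ℝ) ^ 2)
      (fun t _ => by positivity) ht₀
  have hE0 : 0 ≤ E := (Real.exp_pos _).le.trans hexp
  have hs3 : s ^ 3 ≤ 8 * L ^ 3 + 6 * E := by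
    have h1 := pow_le_pow_add_factorial_mul_exp hs0 hτ0 3
    have h2 : τ ^ 3 ≤ (2 * L) ^ 3 := pow_le_pow_left₀ hτ0 hτL 3
    have h3 : ((Nat.factorial 3 : ℕ) : ℝ) = 6 := by norm_num [Nat.factorial]
    rw [h3] at h1
    linarith [mul_pow 2 L 3]
  have hs2 : s ^ 2 ≤ 4 * L ^ 2 + 2 * E := by
    have h1 := pow_le_pow_add_factorial_mul_exp hs0 hτ0 2
    have h2 : τ ^ 2 ≤ (2 * L) ^ 2 := pow_le_pow_left₀ hτ0 hτL 2
    have h3 : ((Nat.factorial 2 : ℕ) : ℝ) = 2 := by norm_num [Nat.factorial]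
    rw [h3] at h1
    linarith [mul_pow 2 L 2]
  have hq3 : (L + s) ^ 3 ≤ 36 * L ^ 3 + 24 * E := by
    have : (L + s) ^ 3 ≤ 4 * (L ^ 3 + s ^ 3) := by
      have h1 : 0 ≤ (L + s) * (L - s) ^ 2 :=
        mul_nonneg (add_nonneg (by linarith) hs0) (sq_nonneg _)
      linarith [show 4 * (L ^ 3 + s ^ 3) - (L + s) ^ 3 = 3 * ((L + s) * (L - s) ^ 2) by ring]
    linarith
  have hB0 : 0 ≤ ∑ t ∈ Finset.range T, b t := Finset.sum_nonneg fun t _ => hb0 t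
  have hBT : ∑ t ∈ Finset.range T, b t ≤ T := by
    calc _ ≤ ∑ t ∈ Finset.range T, (1 : ℝ) := Finset.sum_le_sum fun t _ => hb1 t
      _ = _ := by simp
  -- Noise and failures are dependent. The logarithmic part of (1+s)² keeps the failure count; the
  -- exponential part uses the trivial bound T on it, so the result is linear in both.
  have hp2 : 4 * (1 + s) ^ 2 * ∑ t ∈ Finset.range T, b t
      ≤ 40 * L ^ 2 * ∑ t ∈ Finset.range T, b t + 16 * T * E := by
    have h1 : 4 * (1 + s) ^ 2 ≤ 40 * L ^ 2 + 16 * E := by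
      have h2 : 1 ≤ L ^ 2 := one_le_pow₀ hL1
      linarith [sq_nonneg (1 - s), show (1 + s) ^ 2 + (1 - s) ^ 2 = 2 + 2 * s ^ 2 by ring]
    calc _ ≤ (40 * L ^ 2 + 16 * E) * ∑ t ∈ Finset.range T, b t := by gcongr
      _ = 40 * L ^ 2 * ∑ t ∈ Finset.range T, b t + 16 * (∑ t ∈ Finset.range T, b t) * E := by ring
      _ ≤ _ := by gcongr
  have hpc := (pathConst_pos hlam).le
  gcongr

end

/-! ### Integrability, optimality of the greedy policy, and expected regret -/

section

variable {Ω : Type*} {mΩ : MeasurableSpace Ω} {μ : Measure Ω} [IsProbabilityMeasure μ]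
  {ℱ : Filtration ℕ mΩ} {ξ : ℕ → Ω → ℝ} {n k T : ℕ} {m σ Γ lam : ℝ}
  {γ : Fin n → Fin (k + 1) → ℝ} {g π : Policy n}

lemma integrable_totalReward (hγ : ∀ a i, 0 ≤ γ a i) (hΓ1 : Γ < 1)
    (hΓ : ∀ a, ∑ i : Fin k, γ a i.succ ≤ Γ) (hm : ∀ a, γ a 0 ≤ m) (hm0 : 0 ≤ m)
    (hξ : IsSubgaussianNoise μ ℱ ξ σ) (π : Policy n) (T : ℕ) :
    Integrable (fun ω => totalReward γ π (fun t => ξ t ω) T) μ := by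
  have hmeas : Measurable fun ω => totalReward γ π (fun t => ξ t ω) T := by
    have h := (measurable_trajectory hξ.measurable γ π T).mono (ℱ.le T) le_rfl
    exact Finset.measurable_sum _ fun s _ => (measurable_pi_iff.1 h s).snd
  have hexp : ∀ t, Integrable (fun ω => Real.exp (1 * |ξ (t + 1) ω|)) μ := fun t =>
    (integrable_exp_abs hξ t 1).1
  have hdom : Integrable (fun ω => T * ((m + ∑ t ∈ Finset.range T,
      Real.exp (1 * |ξ (t + 1) ω|)) / (1 - Γ))) μ :=
    ((((integrable_const m).add (integrable_finsetSum _ fun t _ => hexp t)).div_const _).const_mul _)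
  refine hdom.mono' hmeas.aestronglyMeasurable (Filter.Eventually.of_forall fun ω => ?_)
  rw [totalReward_eq, Real.norm_eq_abs]
  have hb : ∀ t < T, |ξ (t + 1) ω| ≤ ∑ t ∈ Finset.range T, Real.exp (1 * |ξ (t + 1) ω|) := by
    intro t ht
    calc |ξ (t + 1) ω| ≤ Real.exp (1 * |ξ (t + 1) ω|) := by
          rw [one_mul]; linarith [Real.add_one_le_exp |ξ (t + 1) ω|]
      _ ≤ _ := Finset.single_le_sum (f := fun t => Real.exp (1 * |ξ (t + 1) ω|))
          (fun t _ => (Real.exp_pos _).le) (Finset.mem_range.2 ht)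
  calc _ ≤ ∑ t ∈ Finset.range T, |reward γ π (fun t => ξ t ω) (t + 1)| :=
        Finset.abs_sum_le_sum_abs _ _
    _ ≤ ∑ _t ∈ Finset.range T, (m + ∑ t ∈ Finset.range T, Real.exp (1 * |ξ (t + 1) ω|))
          / (1 - Γ) := by
        refine Finset.sum_le_sum fun t ht => ?_
        exact abs_reward_le π _ hγ hΓ1 hΓ hm hm0
          (Finset.sum_nonneg fun t _ => (Real.exp_pos _).le) hb
          (Nat.succ_le_of_lt (Finset.mem_range.1 ht))
    _ = _ := by simp

omit [IsProbabilityMeasure μ] in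
lemma isOptimal_of_isGreedy (hγ : ∀ a i, 0 ≤ γ a i) (hg : IsGreedy γ g)
    (hint : ∀ π : Policy n, Integrable (fun ω => totalReward γ π (fun t => ξ t ω) T) μ) :
    IsOptimal μ ξ γ T g := by
  intro π
  refine integral_mono (hint π) (hint g) fun ω => ?_
  simp only [totalReward_eq]
  exact Finset.sum_le_sum fun t _ => reward_le_greedy π _ hγ hg _

lemma integral_affine {f h : Ω → ℝ} (hf : Integrable f μ) (hh : Integrable h μ) (a b c : ℝ) :
    Integrable (fun ω => a + (b * f ω + c * h ω)) μ ∧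
      ∫ ω, (a + (b * f ω + c * h ω)) ∂μ = a + (b * ∫ ω, f ω ∂μ + c * ∫ ω, h ω ∂μ) := by
  have h1 : Integrable (fun ω => b * f ω) μ := hf.const_mul b
  have h2 : Integrable (fun ω => c * h ω) μ := hh.const_mul c
  have h3 : Integrable (fun ω => b * f ω + c * h ω) μ := h1.add h2
  refine ⟨(integrable_const a).add h3, ?_⟩
  rw [integral_add (integrable_const a) h3, integral_add h1 h2, integral_const_mul,
    integral_const_mul]
  simp

/-- The constant under the square root of the regret bound. -/
noncomputable def momentConst (lam : ℝ) : ℝ :=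
  pathConst lam * (36 + 48 * Real.exp 2) + (20 + 32 * Real.exp 2)

lemma momentConst_pos {lam : ℝ} (hlam : 0 < lam) : 0 < momentConst lam := by
  have := pathConst_pos hlam
  unfold momentConst; positivity

lemma expectedReward_greedy_sub_le (hn : 1 ≤ n) (hT : 1 ≤ T) (hσ : 0 ≤ σ) (hlam : 0 < lam)
    (hγ : ∀ a i, 0 ≤ γ a i) (hΓ0 : 0 ≤ Γ) (hΓ1 : Γ < 1) (hΓ : ∀ a, ∑ i : Fin k, γ a i.succ ≤ Γ)
    (hm : ∀ a, γ a 0 ≤ m) (hm0 : 0 ≤ m) (hρ : 0 < m + σ) (hg : IsGreedy γ g)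
    (hπ : IsARUCB k lam m σ (1 / (2 * (T : ℝ))) T π) (hξ : IsSubgaussianNoise μ ℱ ξ σ) {L : ℝ}
    (hL : L = 1 + Real.log (n * T * (k + 1) * (1 + m + σ) / (1 - Γ))) :
    expectedReward μ ξ γ T g - expectedReward μ ξ γ T π
      ≤ √(momentConst lam) * ((m + σ + 1) * ((k : ℝ) + 1) ^ (3 / 2 : ℝ) * √((n : ℝ) * T)
          / (1 - Γ) ^ 2) * L ^ 2 := by
  obtain ⟨l1, l2, l3, l4, l5⟩ := log_factors_le (k := k) hn hT hm0 hσ hΓ0 hΓ1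
  have hn' : (1 : ℝ) ≤ n := by exact_mod_cast hn
  have hT' : (1 : ℝ) ≤ T := by exact_mod_cast hT
  have hd : (1 : ℝ) ≤ k + 1 := by linarith [(Nat.cast_nonneg k : (0 : ℝ) ≤ k)]
  have hg0 : 0 < 1 - Γ := by linarith
  have hL1 : 1 ≤ L := by rw [hL, l5]; linarith
  have hpc := pathConst_pos hlam
  have hmc := momentConst_pos hlam
  have hint := fun π => integrable_totalReward (T := T) hγ hΓ1 hΓ hm hm0 hξ π
  set M := √(momentConst lam) * ((m + σ + 1) * ((k : ℝ) + 1) ^ (3 / 2 : ℝ) * √((n : ℝ) * T)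
          / (1 - Γ) ^ 2) * L ^ 2 with hM
  have hM0 : 0 < M := by positivity
  let bad : ℕ → Set Ω := fun t =>
    {ω | ¬ Concentrated γ π (fun s => ξ s ω) lam σ (1 / (2 * (T : ℝ))) t}
  have hbadm : ∀ t, MeasurableSet (bad t) := fun t =>
    (measurableSet_concentrated γ π hξ.measurable _ t).compl
  let b : ℕ → Ω → ℝ := fun t => (bad t).indicator 1
  have hbint : ∀ t, Integrable (b t) μ := fun t =>
    (integrable_const (1 : ℝ)).indicator (hbadm t)
  have hbval : ∀ t, ∫ ω, b t ω ∂μ ≤ 1 / (2 * (T : ℝ)) := fun t => by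
    rw [integral_indicator_one (hbadm t)]
    exact measure_not_concentrated_le hlam hσ hn hξ (by positivity) t
  let E : Ω → ℝ := fun ω =>
    ∑ t ∈ Finset.range T, Real.exp (2 / (m + σ) * |ξ (t + 1) ω|) / T ^ 2
  have hEint : Integrable E μ := integrable_finsetSum _ fun t _ =>
    (integrable_exp_abs hξ t _).1.div_const _
  have hEval : ∫ ω, E ω ∂μ ≤ 2 * Real.exp 2 / T := by
    show ∫ ω, ∑ t ∈ Finset.range T, Real.exp (2 / (m + σ) * |ξ (t + 1) ω|) / T ^ 2 ∂μ ≤ _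
    rw [integral_finsetSum _ fun t _ => (integrable_exp_abs hξ t _).1.div_const _]
    have hone : ∀ t, ∫ ω, Real.exp (2 / (m + σ) * |ξ (t + 1) ω|) / T ^ 2 ∂μ
        ≤ 2 * Real.exp 2 / T ^ 2 := fun t => by
      rw [integral_div]
      have h1 : σ ^ 2 * (2 / (m + σ)) ^ 2 / 2 ≤ 2 := by
        -- This reduces to σ² ≤ (m+σ)².
        rw [div_pow, mul_div_assoc', div_div, div_le_iff₀ (by positivity)]
        nlinarith
      have h2 := (integrable_exp_abs hξ t (2 / (m + σ))).2
      have h3 := Real.exp_le_exp.2 h1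
      gcongr
      linarith
    calc _ ≤ ∑ t ∈ Finset.range T, 2 * Real.exp 2 / (T : ℝ) ^ 2 :=
          Finset.sum_le_sum fun t _ => hone t
      _ = _ := by
          rw [Finset.sum_const, Finset.card_range, nsmul_eq_mul]
          field_simp
  let B : Ω → ℝ := fun ω => ∑ t ∈ Finset.range T, b t ω
  have hBint : Integrable B μ := integrable_finsetSum _ fun t _ => hbint t
  have hBval : ∫ ω, B ω ∂μ ≤ 1 / 2 := by
    show ∫ ω, ∑ t ∈ Finset.range T, b t ω ∂μ ≤ _
    rw [integral_finsetSum _ fun t _ => hbint t]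
    calc _ ≤ ∑ t ∈ Finset.range T, 1 / (2 * (T : ℝ)) := Finset.sum_le_sum fun t _ => hbval t
      _ = _ := by
          rw [Finset.sum_const, Finset.card_range, nsmul_eq_mul]
          field_simp
  let Z : Ω → ℝ := fun ω => pathConst lam * (36 * L ^ 3 + 24 * E ω)
          + (40 * L ^ 2 * B ω + 16 * T * E ω)
  obtain ⟨hZint, e⟩ : Integrable Z μ ∧
      ∫ ω, Z ω ∂μ = pathConst lam * (36 * L ^ 3 + 24 * ∫ ω, E ω ∂μ)
        + (40 * L ^ 2 * ∫ ω, B ω ∂μ + 16 * T * ∫ ω, E ω ∂μ) := by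
    have hZ : Z = fun ω => 36 * pathConst lam * L ^ 3
        + ((24 * pathConst lam + 16 * T) * E ω + 40 * L ^ 2 * B ω) := by
      funext ω; simp only [Z]; ring
    obtain ⟨h1, h2⟩ := integral_affine hEint hBint (36 * pathConst lam * L ^ 3)
      (24 * pathConst lam + 16 * T) (40 * L ^ 2)
    rw [hZ]
    exact ⟨h1, h2.trans (by ring)⟩
  have hZval : ∫ ω, Z ω ∂μ ≤ momentConst lam * L ^ 4 := by
    have e2 : T * ∫ ω, E ω ∂μ ≤ 2 * Real.exp 2 := by
      have := mul_le_mul_of_nonneg_left hEval (by positivity : (0 : ℝ) ≤ T)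
      rwa [mul_div_cancel₀ _ (by positivity)] at this
    have e3 : ∫ ω, E ω ∂μ ≤ 2 * Real.exp 2 := hEval.trans (div_le_self (by positivity) hT')
    have p2 : L ^ 2 ≤ L ^ 4 := pow_le_pow_right₀ hL1 (by norm_num)
    have p3 : L ^ 3 ≤ L ^ 4 := pow_le_pow_right₀ hL1 (by norm_num)
    have p4 : 1 ≤ L ^ 4 := one_le_pow₀ hL1
    have pe := Real.exp_pos 2
    have f1 : 36 * L ^ 3 + 24 * ∫ ω, E ω ∂μ ≤ (36 + 48 * Real.exp 2) * L ^ 4 := by nlinarith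
    have f2 : 40 * L ^ 2 * ∫ ω, B ω ∂μ ≤ 20 * L ^ 4 := by
      have : 40 * L ^ 2 * ∫ ω, B ω ∂μ ≤ 40 * L ^ 2 * (1 / 2) := by gcongr
      linarith
    have f3 : 16 * T * ∫ ω, E ω ∂μ ≤ 32 * Real.exp 2 * L ^ 4 := by nlinarith
    have f4 := mul_le_mul_of_nonneg_left f1 hpc.le
    rw [e, momentConst]
    linarith
  set W := (k + 1) / (1 - Γ) ^ 2 * ((m + σ + 1) ^ 2 / (1 - Γ) ^ 2 * (n * (k + 1) ^ 2)) with hW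
  have hW0 : 0 < W := by positivity
  -- `M` is the target bound; this is the Cauchy–Schwarz value √(T · W · E[Z]) with E[Z] replaced by
  -- its bound.
  have hM2 : M ^ 2 = W * (momentConst lam * L ^ 4) * T := by
    have r1 : (((k : ℝ) + 1) ^ (3 / 2 : ℝ)) ^ 2 = ((k : ℝ) + 1) ^ 3 := by
      rw [← Real.rpow_natCast, ← Real.rpow_mul (by positivity), ← Real.rpow_natCast]
      norm_num
    have r2 := Real.sq_sqrt (show (0 : ℝ) ≤ n * T by positivity)
    have r3 := Real.sq_sqrt hmc.le
    rw [hM, mul_pow, mul_pow, div_pow, mul_pow, mul_pow, r1, r2, r3, hW]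
    field_simp
  have hpath : ∀ ω, totalReward γ g (fun t => ξ t ω) T - totalReward γ π (fun t => ξ t ω) T
      ≤ M / 2 + T / (2 * M) * (W * Z ω) := by
    intro ω
    set ζ : ℕ → ℝ := fun t => ξ t ω with hζ
    have h1 := sum_sq_greedy_sub_reward_le π ζ hγ hΓ0 hΓ1 hΓ hg T
    have h2 := sum_sq_instRegret_le_exp (g := g) (ξ := ζ) hn hT hσ hlam hγ hΓ0 hΓ1 hΓ hm hm0 hρ hg
      hπ hL (b := fun t => b t ω) (fun t => Set.indicator_nonneg (fun _ _ => zero_le_one) _)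
      (fun t => Set.indicator_le_self' (fun _ _ => zero_le_one) _)
      (fun t ht => by
        show 1 ≤ (bad t).indicator 1 ω
        rw [Set.indicator_of_mem (show ω ∈ bad t from ht)]; rfl) (E := E ω) rfl
    have h3 : ∑ t ∈ Finset.range T, (reward γ g ζ (t + 1) - reward γ π ζ (t + 1)) ^ 2
        ≤ W * Z ω := by
      refine h1.trans ?_
      rw [hW, mul_assoc]
      gcongr
    rw [totalReward_eq, totalReward_eq, ← Finset.sum_sub_distrib]
    -- AM-GM with the deterministic weight `M` replaces Cauchy–Schwarz in time and Jensen in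
    -- expectation, so no square root has to be integrated.
    have h4 : ∀ d : ℝ, d ≤ M / (2 * T) + T / (2 * M) * d ^ 2 := fun d => by
      have : 0 ≤ (M - T * d) ^ 2 / (2 * T * M) := by positivity
      have e : M / (2 * T) + T / (2 * M) * d ^ 2 - d = (M - T * d) ^ 2 / (2 * T * M) := by
        field_simp; ring
      linarith
    calc _ ≤ ∑ t ∈ Finset.range T, (M / (2 * T) + T / (2 * M)
          * (reward γ g ζ (t + 1) - reward γ π ζ (t + 1)) ^ 2) :=
          Finset.sum_le_sum fun t _ => h4 _
      _ = M / 2 + T / (2 * M)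
          * ∑ t ∈ Finset.range T, (reward γ g ζ (t + 1) - reward γ π ζ (t + 1)) ^ 2 := by
          rw [Finset.sum_add_distrib, Finset.mul_sum, Finset.sum_const, Finset.card_range,
            nsmul_eq_mul]
          congr 1
          field_simp
      _ ≤ _ := by gcongr
  rw [expectedReward, expectedReward, ← integral_sub (hint g) (hint π)]
  calc _ ≤ ∫ ω, (M / 2 + T / (2 * M) * (W * Z ω)) ∂μ :=
        integral_mono ((hint g).sub (hint π))
          ((integrable_const _).add ((hZint.const_mul W).const_mul _)) hpath
    _ = M / 2 + T / (2 * M) * (W * ∫ ω, Z ω ∂μ) := by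
        rw [integral_add (integrable_const _) ((hZint.const_mul W).const_mul _),
          integral_const_mul, integral_const_mul]
        simp
    _ ≤ M / 2 + T / (2 * M) * (W * (momentConst lam * L ^ 4)) := by gcongr
    _ = M / 2 + M ^ 2 / (2 * M) := by rw [hM2]; ring
    _ = M := by field_simp; ring

end

end ARBandit

theorem theorem2 :
    ∃ p : ℕ, ∀ lam c₀ : ℝ, 0 < lam → 0 < c₀ → ∃ C : ℝ, 0 < C ∧
      ∀ (n k T : ℕ) (m σ Γ : ℝ) (γ : Fin n → Fin (k + 1) → ℝ),
        1 ≤ n → 1 ≤ T → 0 ≤ σ → c₀ ≤ m ^ 2 + σ →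
        -- monotonicity, stability and boundedness
        (∀ a i, 0 ≤ γ a i) →
        Γ < 1 → (∀ a, ∑ i : Fin k, γ a i.succ ≤ Γ) →
        (∀ a, γ a 0 ≤ m) →
        -- the noise
        ∀ (Ω : Type*) [mΩ : MeasurableSpace Ω] (μ : Measure Ω) [IsProbabilityMeasure μ]
          (ℱ : Filtration ℕ mΩ) (ξ : ℕ → Ω → ℝ),
          ARBandit.IsSubgaussianNoise μ ℱ ξ σ →
          -- the expected rewards are finite and an optimal policy exists
          (∀ π : ARBandit.Policy n,
            Integrable (fun ω => ARBandit.totalReward γ π (fun t => ξ t ω) T) μ) ∧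
          (∃ πopt : ARBandit.Policy n, ARBandit.IsOptimal μ ξ γ T πopt) ∧
          -- the regret of AR-UCB with confidence `δ = 1 / (2 T)`
          ∀ π πopt : ARBandit.Policy n,
            ARBandit.IsARUCB k lam m σ (1 / (2 * (T : ℝ))) T π →
            ARBandit.IsOptimal μ ξ γ T πopt →
            ARBandit.expectedReward μ ξ γ T πopt - ARBandit.expectedReward μ ξ γ T π ≤
              C * ((m ^ 2 + σ) * ((k : ℝ) + 1) ^ (3 / 2 : ℝ) * √((n : ℝ) * (T : ℝ))
                  / (1 - Γ) ^ 2)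
                * (1 + Real.log ((n : ℝ) * (T : ℝ) * ((k : ℝ) + 1) * (1 + m + σ) / (1 - Γ))) ^ p := by
  -- The exponent 2 comes from the square root of the moment bound, a constant times L⁴.
  refine ⟨2, fun lam c₀ hlam hc₀ =>
    ⟨√(ARBandit.momentConst lam) * (1 + 2 / c₀), ?_, ?_⟩⟩
  · have := ARBandit.momentConst_pos hlam
    positivity
  intro n k T m σ Γ γ hn hT hσ hc hγ hΓ1 hΓ hm Ω mΩ μ _ ℱ ξ hξ
  have hm0 : 0 ≤ m := (hγ ⟨0, hn⟩ 0).trans (hm ⟨0, hn⟩)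
  have hΓ0 : 0 ≤ Γ := (Finset.sum_nonneg fun i _ => hγ ⟨0, hn⟩ (Fin.succ i)).trans (hΓ ⟨0, hn⟩)
  have hρ : 0 < m + σ := by
    rcases hm0.eq_or_lt with h | h
    · rw [← h] at hc ⊢
      linarith [hc]
    · linarith
  obtain ⟨g, hg⟩ := ARBandit.exists_isGreedy hn γ
  have hint := fun π => ARBandit.integrable_totalReward (T := T) hγ hΓ1 hΓ hm hm0 hξ π
  have hopt := ARBandit.isOptimal_of_isGreedy (μ := μ) (ξ := ξ) (T := T) hγ hg hint
  refine ⟨hint, ⟨g, hopt⟩, fun π πopt hπ _ => ?_⟩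
  have hbound := ARBandit.expectedReward_greedy_sub_le hn hT hσ hlam hγ hΓ0 hΓ1 hΓ hm hm0 hρ hg hπ
    hξ rfl
  refine (sub_le_sub_right (hopt πopt) _).trans (hbound.trans ?_)
  have hg0 : 0 < 1 - Γ := by linarith
  -- The lower bound c₀ absorbs additive constants: m + 1 ≤ m² + 2 and 2 ≤ 2(m² + σ)/c₀.
  have hscale : m + σ + 1 ≤ (1 + 2 / c₀) * (m ^ 2 + σ) := by
    have h1 : 1 ≤ (m ^ 2 + σ) / c₀ := by rwa [one_le_div hc₀]
    have h2 : (1 + 2 / c₀) * (m ^ 2 + σ) = m ^ 2 + σ + 2 * ((m ^ 2 + σ) / c₀) := by ring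
    rw [h2]
    nlinarith [sq_nonneg (m - 1)]
  calc _ ≤ √(ARBandit.momentConst lam) * ((1 + 2 / c₀) * (m ^ 2 + σ)
        * ((k : ℝ) + 1) ^ (3 / 2 : ℝ) * √((n : ℝ) * T) / (1 - Γ) ^ 2)
        * (1 + Real.log (n * T * (k + 1) * (1 + m + σ) / (1 - Γ))) ^ 2 := by gcongr
    _ = _ := by ring
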